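/- Let $\mathbb C_R=\{s\in\mathbb C:\operatorname{Re}s>0\}$ and let $\eta\in(1,\infty]$, where $\frac{\eta+1}{\eta-1}:=1$ for $\eta=\infty$. An $m\times m$-valued rational function $G(s)$ with complex coefficients belongs to $\mathcal{HB}_\eta$ if it is analytic in $\mathbb C_R$ and $$I_m-\tfrac{\eta+1}{\eta-1}\,G(s)^*G(s)\ \text{ is positive semidefinite for all } s\in\mathbb C_R .$$ Let $G(s)$ be an $m\times m$-valued rational function with no pole at infinity, of McMillan degree $n$ (the least state space dimension of a realization), and let $G(s)=\hat C(sI_n-\hat A)^{-1}\hat B+\hat D$ be a corresponding minimal realization, with complex matrices $\hat A,\hat B,\hat C,\hat D$ of sizes $n\times n$, $n\times m$, $m\times n$, $m\times m$. For an $n\times n$ matrix $H$ put $$M_\eta(H)=\begin{pmatrix}-H\hat A-\hat A^*H&-H\hat B\\-\hat B^*H&I_m\end{pmatrix}-\tfrac{\eta+1}{\eta-1}\begin{pmatrix}\hat C^*\\ \hat D^*\end{pmatrix}\begin{pmatrix}\hat C&\hat D\end{pmatrix}.$$ Then, for every $\eta\in(1,\infty]$: (i) $G\in\mathcal{HB}_\eta$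 if and only if there exists a (Hermitian) positive definite $n\times n$ matrix $H$ such that $M_\eta(H)$ is positive semidefinite. (ii) Moreover, if $n\ge 1$ and $G\in\mathcal{HB}_\eta$, then $H$ in (i) can be chosen so that $M_\eta(H)$ is, in addition, singular. (iii) If $\eta$ is the smallest element of $(1,\infty]$ for which $G\in\mathcal{HB}_\eta$, then (for every $n\ge 0$) $M_\eta(H)$ is singular for every positive definite $H$ for which $M_\eta(H)$ is positive semidefinite. -/

import Mathlib

open scoped Matrix ComplexOrder

namespace HyperBounded

/-- An `m × m`-valued rational function of one complex variable. -/
abbrev RatMatrix (m : ℕ) : Type := Matrix (Fin m) (Fin m) (RatFunc ℂ)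

/-- The value at the point `s` (meaningful where no entry has a pole). -/
noncomputable def evalAt {m : ℕ} (G : RatMatrix m) (s : ℂ) : Matrix (Fin m) (Fin m) ℂ :=
  G.map (RatFunc.eval (RingHom.id ℂ) s)

/-- `G` is analytic at the point `s`: no entry, in lowest terms, has a pole there. -/
def IsAnalyticAt {m : ℕ} (G : RatMatrix m) (s : ℂ) : Prop :=
  ∀ i j, (G i j).denom.eval s ≠ 0

/-- `G` has no pole at infinity: every entry is proper. -/
def NoPoleAtInfinity {m : ℕ} (G : RatMatrix m) : Prop :=
  ∀ i j, (G i j).num.natDegree ≤ (G i j).denom.natDegree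

/-- `G(s) = C (s I_n - A)⁻¹ B + D` as an identity of matrices of rational functions.
The matrix `s I_n - A` is always invertible over the field of rational functions. -/
def IsRealization {m n : ℕ} (G : RatMatrix m)
    (A : Matrix (Fin n) (Fin n) ℂ) (B : Matrix (Fin n) (Fin m) ℂ)
    (C : Matrix (Fin m) (Fin n) ℂ) (D : Matrix (Fin m) (Fin m) ℂ) : Prop :=
  G = C.map RatFunc.C * (Matrix.scalar (Fin n) (RatFunc.X : RatFunc ℂ) - A.map RatFunc.C)⁻¹ *
        B.map RatFunc.C + D.map RatFunc.C

/-- The McMillan degree of a rational function without pole at infinity: the least state space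
dimension of a realization. -/
noncomputable def mcMillanDegree {m : ℕ} (G : RatMatrix m) : ℕ :=
  sInf {n : ℕ | ∃ (A : Matrix (Fin n) (Fin n) ℂ) (B : Matrix (Fin n) (Fin m) ℂ)
    (C : Matrix (Fin m) (Fin n) ℂ) (D : Matrix (Fin m) (Fin m) ℂ), IsRealization G A B C D}

/-- The number `(η + 1) / (η - 1)` for `η ∈ (1, ∞]`, with the value `1` at `η = ∞`. -/
noncomputable def weight (η : EReal) : ℝ :=
  if η = ⊤ then 1 else (η.toReal + 1) / (η.toReal - 1)

/-- The class `HB_η`: `G` is analytic in the open right half plane and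
`I - ((η + 1) / (η - 1)) G(s)* G(s)` is positive semidefinite there. -/
def HB {m : ℕ} (η : EReal) (G : RatMatrix m) : Prop :=
  ∀ s : ℂ, 0 < s.re → IsAnalyticAt G s ∧
    (1 - (weight η : ℂ) • ((evalAt G s)ᴴ * evalAt G s)).PosSemidef

/-- The matrix
`[-HA - A*H, -HB; -B*H, I_m] - ((η + 1) / (η - 1)) [C*; D*] [C, D]`. -/
noncomputable def brlMatrix {m n : ℕ} (η : EReal)
    (A : Matrix (Fin n) (Fin n) ℂ) (B : Matrix (Fin n) (Fin m) ℂ)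
    (C : Matrix (Fin m) (Fin n) ℂ) (D : Matrix (Fin m) (Fin m) ℂ)
    (H : Matrix (Fin n) (Fin n) ℂ) : Matrix (Fin n ⊕ Fin m) (Fin n ⊕ Fin m) ℂ :=
  Matrix.fromBlocks (-(H * A) - Aᴴ * H) (-(H * B)) (-(Bᴴ * H)) 1 -
    (weight η : ℂ) • (Matrix.fromRows Cᴴ Dᴴ * Matrix.fromCols C D)

end HyperBounded

/-!
The theorem is the nonstrict bounded real lemma for a minimal realization.

Write `brlMatrix = supply - storageRate`, where `supply` is the Hermitian form
`|u|² - w |C x + D u|²`, with `w` the weight of `η`, and `storageRate` is the form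
`2 Re ⟨x, H (A x + B u)⟩`, linear in `H`. At the pairs with `A x + B u = s x` the difference equals
`|u|² - w |G(s) u|² - 2 Re s ⟨x, H x⟩` (`dissipation_eq`). If it is nonnegative and `H` is positive
definite, then `A` has no eigenvalue in the open right half plane and `w G(s)ᴴ G(s) ≤ 1` there;
this is `HB.of_storage`, and it uses no minimality.

For the converse, a minimal realization is controllable and observable, since otherwise its state
space could be cut down. Boundedness of `G` then keeps the eigenvalues of `A` out of the closed
right half plane (`IsContractive.isUnit_det`), and by continuity the inequality for `G` holds on
the imaginary axis and at infinity. The Kalman–Yakubovich–Popov lemma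
(`exists_posSemidef_sub_storageRate`) now gives a Hermitian `H`. Its proof separates `supply` from
the cone of all matrices `P + storageRate A B H` with `P ≥ 0`. The cone is closed because, for a
controllable pair, `-storageRate A B H ≥ 0` only if `H = 0`
(`eq_zero_of_posSemidef_neg_storageRate`): this takes the place of a perturbation of the inequality
to a strict one. A separating functional is the trace against some `W Wᴴ`, and
`exists_unitary_of_skew` rotates the columns of `W` into pairs `(x, u)` with `A x + B u = i ω x` or
`x = 0`, on which the form is known to be nonnegative. Finally Lyapunov's theorem and observability
make `H` positive definite (`posDef_of_posSemidef_sub_storageRate`).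

The same triviality of `-storageRate A B H ≥ 0` bounds the set of `t ≥ 0` for which `H + t` is a
solution; at the largest such `t` the matrix is singular, as positive definiteness is an open
condition. For the same reason a nonsingular `brlMatrix η` would stay positive definite for slightly
smaller `η`, so it cannot occur for the least `η`.
-/

namespace HyperBounded

open Filter Topology

/-! ### Positive semidefinite matrices, closed cones and trace functionals -/

section Cones

variable {ι κ : Type*} [Fintype ι] [Fintype κ]

theorem isClosed_posSemidef : IsClosed {M : Matrix ι ι ℂ | M.PosSemidef} := by
  have : {M : Matrix ι ι ℂ | M.PosSemidef} =
      {M | Mᴴ = M} ∩ ⋂ x : ι → ℂ, {M | 0 ≤ star x ⬝ᵥ (M *ᵥ x)} := by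
    ext M
    simp [Matrix.posSemidef_iff_dotProduct_mulVec, Matrix.IsHermitian]
  rw [this]
  refine (isClosed_eq (by fun_prop) continuous_id).inter (isClosed_iInter fun x => ?_)
  exact isClosed_le continuous_const (by fun_prop)

/-- A linear map that vanishes on a closed cone only at the origin maps the cone to a closed
set: on the compact set of unit vectors of the cone the norm of the image is bounded away from
`0`, so preimages of bounded sets are bounded. -/
theorem isClosed_image_of_cone {E F : Type*} [NormedAddCommGroup E] [NormedSpace ℝ E]
    [ProperSpace E] [NormedAddCommGroup F] [NormedSpace ℝ F] (f : E →L[ℝ] F) {K : Set E}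
    (hK : IsClosed K) (hcone : ∀ c : ℝ, 0 < c → ∀ x ∈ K, c • x ∈ K)
    (h0 : ∀ x ∈ K, f x = 0 → x = 0) : IsClosed (f '' K) := by
  obtain ⟨c, hc, hcf⟩ : ∃ c > 0, ∀ x ∈ K, c * ‖x‖ ≤ ‖f x‖ := by
    have hS : IsCompact (K ∩ Metric.sphere 0 1) := (isCompact_sphere 0 1).inter_left hK
    rcases (K ∩ Metric.sphere 0 1).eq_empty_or_nonempty with he | hne
    · refine ⟨1, one_pos, fun x hx => ?_⟩
      by_cases hx0 : x = 0
      · simp [hx0]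
      · have : ‖x‖⁻¹ • x ∈ K ∩ Metric.sphere 0 1 :=
          ⟨hcone _ (by positivity) x hx, by simp [norm_smul, hx0]⟩
        simp [he] at this
    · obtain ⟨y, hy, hmin⟩ := hS.exists_isMinOn hne (f := fun x => ‖f x‖) (by fun_prop)
      refine ⟨‖f y‖, norm_pos_iff.2 fun h => ?_, fun x hx => ?_⟩
      · have := h0 y hy.1 h
        simp [this] at hy
      by_cases hx0 : x = 0
      · simp [hx0]
      · have hx' : ‖x‖⁻¹ • x ∈ K ∩ Metric.sphere 0 1 :=
          ⟨hcone _ (by positivity) x hx, by simp [norm_smul, hx0]⟩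
        have := hmin hx'
        simp only [Set.mem_ofPred_eq, map_smul, norm_smul, norm_inv, norm_norm] at this
        rw [inv_mul_eq_div, le_div_iff₀ (by positivity)] at this
        exact this
  refine isClosed_of_closure_subset fun y hy => ?_
  have hcomp : IsCompact (f '' (K ∩ Metric.closedBall 0 ((‖y‖ + 1) / c))) :=
    ((isCompact_closedBall _ _).inter_left hK).image f.continuous
  have hy' : y ∈ closure (Metric.ball y 1 ∩ f '' K) :=
    Metric.isOpen_ball.inter_closure ⟨Metric.mem_ball_self one_pos, hy⟩
  have hsub : Metric.ball y 1 ∩ f '' K ⊆ f '' (K ∩ Metric.closedBall 0 ((‖y‖ + 1) / c)) := by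
    rintro _ ⟨hb, x, hx, rfl⟩
    refine ⟨x, ⟨hx, ?_⟩, rfl⟩
    rw [mem_closedBall_zero_iff, le_div_iff₀ hc, mul_comm]
    refine (hcf x hx).trans ?_
    have := norm_sub_norm_le (f x) y
    rw [Metric.mem_ball, dist_eq_norm] at hb
    linarith
  exact Set.image_mono Set.inter_subset_left
    (hcomp.isClosed.closure_subset_iff.2 hsub hy')

/-- A real linear functional is, on Hermitian matrices, the real part of the trace against a
Hermitian matrix. -/
theorem exists_isHermitian_trace_eq [DecidableEq ι] (f : Matrix ι ι ℂ →ₗ[ℝ] ℝ) :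
    ∃ Z : Matrix ι ι ℂ, Z.IsHermitian ∧
      ∀ Y : Matrix ι ι ℂ, Y.IsHermitian → f Y = (Z * Y).trace.re := by
  set T : Matrix ι ι ℂ := Matrix.of fun j i =>
    (f (Matrix.single i j 1) : ℂ) - Complex.I * f (Matrix.single i j Complex.I) with hT
  have hfT : ∀ Y : Matrix ι ι ℂ, f Y = (T * Y).trace.re := by
    intro Y
    have hsingle : ∀ (i j : ι) (z : ℂ), Matrix.single i j z =
        z.re • Matrix.single i j (1 : ℂ) + z.im • Matrix.single i j Complex.I := by
      intro i j z
      rw [Matrix.smul_single, Matrix.smul_single, ← Matrix.single_add]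
      congr 1
      simp
    conv_lhs => rw [Matrix.matrix_eq_sum_single Y]
    rw [Matrix.trace, Finset.sum_comm]
    simp only [map_sum, Matrix.diag_apply, Matrix.mul_apply, Complex.re_sum]
    refine Finset.sum_congr rfl fun j _ => Finset.sum_congr rfl fun i _ => ?_
    rw [hsingle, map_add, map_smul, map_smul]
    simp [hT]
    ring
  refine ⟨(1 / 2 : ℝ) • (T + Tᴴ), ?_, fun Y hY => ?_⟩
  · simp [Matrix.IsHermitian, Matrix.conjTranspose_smul, add_comm]
  · have h1 : (Tᴴ * Y).trace = star (T * Y).trace := by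
      rw [← Matrix.trace_conjTranspose, Matrix.conjTranspose_mul, hY.eq, Matrix.trace_mul_comm]
    rw [hfT, Matrix.smul_mul, Matrix.trace_smul, add_mul, Matrix.trace_add, h1]
    simp
    ring

end Cones

/-! ### Unitary factors and skew-Hermitian products -/

section Unitary

variable {ι κ : Type*} [Fintype ι] [Fintype κ]

/-- Two matrices with the same Gram matrix of rows differ by a unitary factor on the right. -/
theorem exists_unitary_mul_eq [DecidableEq κ] {P Q : Matrix ι κ ℂ} (h : P * Pᴴ = Q * Qᴴ) :
    ∃ V : Matrix κ κ ℂ, Vᴴ * V = 1 ∧ P = Q * V := by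
  classical
  let p := Matrix.toLpLin 2 2 Pᴴ
  let q := Matrix.toLpLin 2 2 Qᴴ
  have hnorm : ∀ x, ‖q x‖ = ‖p x‖ := by
    have key : ∀ (R : Matrix ι κ ℂ) (x : EuclideanSpace ℂ ι),
        inner ℂ (Matrix.toLpLin 2 2 Rᴴ x) (Matrix.toLpLin 2 2 Rᴴ x) =
          star x.ofLp ⬝ᵥ ((R * Rᴴ) *ᵥ x.ofLp) := by
      intro R x
      rw [EuclideanSpace.inner_eq_star_dotProduct, Matrix.toLpLin_apply, Matrix.star_mulVec,
        Matrix.conjTranspose_conjTranspose, ← Matrix.mulVec_mulVec, Matrix.dotProduct_mulVec,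
        dotProduct_comm]
    intro x
    rw [← sq_eq_sq₀ (norm_nonneg _) (norm_nonneg _)]
    have h1 := inner_self_eq_norm_sq_to_K (𝕜 := ℂ) (q x)
    have h2 := inner_self_eq_norm_sq_to_K (𝕜 := ℂ) (p x)
    rw [key] at h1 h2
    rw [h, h1] at h2
    exact_mod_cast h2
  have hker : LinearMap.ker q ≤ LinearMap.ker p := by
    intro x hx
    rw [LinearMap.mem_ker] at hx ⊢
    rw [← norm_eq_zero, ← hnorm, hx, norm_zero]
  obtain ⟨g, hg⟩ : ∃ g : LinearMap.range q →ₗᵢ[ℂ] EuclideanSpace ℂ κ,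
      ∀ x, g ⟨q x, LinearMap.mem_range_self q x⟩ = p x := by
    let e := q.quotKerEquivRange
    let g0 : LinearMap.range q →ₗ[ℂ] EuclideanSpace ℂ κ :=
      ((LinearMap.ker q).liftQ p hker).comp e.symm.toLinearMap
    have hg0 : ∀ x, g0 ⟨q x, LinearMap.mem_range_self q x⟩ = p x := by
      intro x
      have : e.symm ⟨q x, LinearMap.mem_range_self q x⟩ = (LinearMap.ker q).mkQ x := by
        rw [LinearEquiv.symm_apply_eq]; rfl
      simp [g0, this]
    refine ⟨⟨g0, ?_⟩, hg0⟩
    rintro ⟨_, x, rfl⟩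
    rw [hg0, ← hnorm]; rfl
  let v := g.extend
  have hv : ∀ x, v (q x) = p x := fun x => by
    rw [← hg x, ← LinearIsometry.extend_apply]
  let W : Matrix κ κ ℂ := (Matrix.toLpLin 2 2).symm v.toLinearMap
  have hW : Matrix.toLpLin 2 2 W = v.toLinearMap := by simp [W]
  have hWP : Pᴴ = W * Qᴴ := by
    apply (Matrix.toLpLin 2 2).injective
    ext1 x
    rw [← hv x]
    have : v (q x) = Matrix.toLpLin 2 2 W (q x) := by rw [hW]; rfl
    rw [this]
    simp [q, Matrix.toLpLin_apply, Matrix.mulVec_mulVec]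
  have hWW : Wᴴ * W = 1 := by
    apply (Matrix.toLpLin 2 2).injective
    ext1 x
    refine ext_inner_left ℂ fun y => ?_
    have h1 : inner ℂ (v y) (v x) = inner ℂ y x := v.inner_map_map y x
    have h2 : ∀ z, v z = Matrix.toLpLin 2 2 W z := fun z => by rw [hW]; rfl
    rw [h2, h2] at h1
    have h3 : Matrix.toLpLin 2 2 (1 : Matrix κ κ ℂ) x = x := by
      ext; simp
    rw [h3, ← h1, EuclideanSpace.inner_eq_star_dotProduct,
      EuclideanSpace.inner_eq_star_dotProduct,
      Matrix.toLpLin_apply, Matrix.toLpLin_apply,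
      Matrix.toLpLin_apply, Matrix.star_mulVec, ← Matrix.mulVec_mulVec,
      dotProduct_comm, Matrix.dotProduct_mulVec, dotProduct_comm]
  refine ⟨Wᴴ, ?_, ?_⟩
  · rw [Matrix.conjTranspose_conjTranspose]
    exact mul_eq_one_comm.1 hWW
  · rw [← Matrix.conjTranspose_conjTranspose P, hWP]
    simp

/-- A unitary matrix is diagonalized by a unitary matrix. Its Cayley transform
`K = i (e + V) (e - V)⁻¹`, with `e` on the unit circle outside the spectrum of `V`, is Hermitian,
and the eigenvectors of `K` are eigenvectors of `V`. -/
theorem exists_unitary_eigenvectors [DecidableEq κ] {V : Matrix κ κ ℂ} (hV : Vᴴ * V = 1) :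
    ∃ U : Matrix κ κ ℂ, U * Uᴴ = 1 ∧ ∀ j, ∃ z : ℂ, ‖z‖ = 1 ∧ V *ᵥ (U.col j) = z • U.col j := by
  obtain ⟨e, he, hdet⟩ : ∃ e : ℂ, ‖e‖ = 1 ∧ IsUnit (e • (1 : Matrix κ κ ℂ) - V).det := by
    have hfin : {z | V.charpoly.IsRoot z}.Finite :=
      Polynomial.finite_setOfPred_isRoot V.charpoly_monic.ne_zero
    have hinf : (Metric.sphere (0 : ℂ) 1).Infinite := by
      refine IsPreconnected.infinite_of_nontrivial
        (isPreconnected_sphere (by simp [Complex.rank_real_complex]) 0 1)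
        ⟨1, by simp, -1, by simp, ?_⟩
      norm_num
    obtain ⟨e, he, hn⟩ := hinf.exists_notMem_finite hfin
    refine ⟨e, by simpa using he, isUnit_iff_ne_zero.2 fun h => hn ?_⟩
    rw [Set.mem_ofPred_eq, Polynomial.IsRoot, Matrix.eval_charpoly, ← h, Matrix.scalar_apply,
      Matrix.smul_one_eq_diagonal]
  have hVV : V * Vᴴ = 1 := mul_eq_one_comm.1 hV
  have hee : star e * e = 1 := by
    rw [Complex.star_def, ← Complex.normSq_eq_conj_mul_self, Complex.normSq_eq_norm_sq, he]; simp
  set N := e • (1 : Matrix κ κ ℂ) - V with hN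
  set S := e • (1 : Matrix κ κ ℂ) + V with hS
  have hcomm : S * N = N * S := by
    simp only [hN, hS, add_mul, mul_sub, sub_mul, mul_add, Matrix.smul_mul, Matrix.mul_smul,
      Matrix.one_mul, Matrix.mul_one]
    abel
  have hNN : N⁻¹ * N = 1 := Matrix.nonsing_inv_mul _ hdet
  have hNN' : N * N⁻¹ = 1 := Matrix.mul_nonsing_inv _ hdet
  -- `Nᴴ S = - Sᴴ N` is the unitarity of `V`, and makes the Cayley transform Hermitian
  have hskew : Nᴴ * S = -(Sᴴ * N) := by
    have : Nᴴ * S + Sᴴ * N = 0 := by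
      simp only [hN, hS, Matrix.conjTranspose_sub, Matrix.conjTranspose_add,
        Matrix.conjTranspose_smul, Matrix.conjTranspose_one, add_mul, mul_sub, sub_mul, mul_add,
        Matrix.smul_mul, Matrix.mul_smul, Matrix.one_mul, Matrix.mul_one, hV,
        smul_smul, hee, mul_comm e]
      abel_nf
      simp
    exact eq_neg_of_add_eq_zero_left this
  set K := Complex.I • (S * N⁻¹) with hK
  have hKH : K.IsHermitian := by
    have h1 : (N⁻¹)ᴴ * Sᴴ = -(S * N⁻¹) := by
      calc (N⁻¹)ᴴ * Sᴴ = (N⁻¹)ᴴ * (Sᴴ * N) * N⁻¹ := by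
            rw [Matrix.mul_assoc, Matrix.mul_assoc, hNN', Matrix.mul_one]
        _ = -((N⁻¹)ᴴ * Nᴴ * (S * N⁻¹)) := by
            rw [eq_neg_of_add_eq_zero_right (eq_neg_iff_add_eq_zero.1 hskew)]
            simp [Matrix.mul_assoc]
        _ = -(S * N⁻¹) := by
            rw [← Matrix.conjTranspose_mul, hNN']; simp
    rw [Matrix.IsHermitian, hK, Matrix.conjTranspose_smul, Matrix.conjTranspose_mul, h1]
    simp
  have hKN : N * K = Complex.I • S := by
    rw [hK, Matrix.mul_smul, ← Matrix.mul_assoc, ← hcomm, Matrix.mul_assoc, hNN', Matrix.mul_one]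
  refine ⟨hKH.eigenvectorUnitary, ?_, fun j => ?_⟩
  · exact (Matrix.mem_unitaryGroup_iff.1 hKH.eigenvectorUnitary.2)
  · set w := (hKH.eigenvectorUnitary : Matrix κ κ ℂ).col j with hw
    set k : ℝ := hKH.eigenvalues j
    have hKw : K *ᵥ w = (k : ℂ) • w := by
      have := hKH.mulVec_eigenvectorBasis j
      rw [hw, hKH.eigenvectorUnitary_col_eq, this]
      ext i
      simp [k]
    have h1 : N *ᵥ ((k : ℂ) • w) = Complex.I • S *ᵥ w := by
      rw [← hKw, Matrix.mulVec_mulVec, hKN, Matrix.smul_mulVec]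
    have h2 : ((k : ℂ) + Complex.I) • V *ᵥ w = (e * (k - Complex.I)) • w := by
      rw [hN, hS, Matrix.sub_mulVec, Matrix.add_mulVec, Matrix.smul_mulVec, Matrix.one_mulVec,
        Matrix.mulVec_smul, Matrix.smul_mulVec, Matrix.one_mulVec] at h1
      ext i
      have := congrFun h1 i
      simp at this ⊢
      linear_combination -this
    have hne : (k : ℂ) + Complex.I ≠ 0 := fun h => by simpa using congrArg Complex.im h
    refine ⟨e * (k - Complex.I) / (k + Complex.I), ?_, ?_⟩
    · have : (k : ℂ) - Complex.I = star ((k : ℂ) + Complex.I) := by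
        simp [sub_eq_add_neg]
      rw [norm_div, norm_mul, he, this, norm_star, one_mul, div_self (norm_ne_zero_iff.2 hne)]
    · rw [div_eq_inv_mul, mul_smul, ← h2, smul_smul, inv_mul_cancel₀ hne, one_smul]

/-- If `X Fᴴ` is skew-Hermitian, then in a suitable orthonormal basis each column `w` satisfies
`X w = 0` or `F w = i ω X w` with real `ω`. The hypothesis says that `X + F` and `X - F` have the
same Gram matrix, hence differ by a unitary factor, whose eigenvectors form the basis. -/
theorem exists_unitary_of_skew [DecidableEq κ] {X F : Matrix ι κ ℂ} (h : X * Fᴴ + F * Xᴴ = 0) :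
    ∃ U : Matrix κ κ ℂ, U * Uᴴ = 1 ∧ ∀ j, X *ᵥ (U.col j) = 0 ∨
      ∃ ω : ℝ, F *ᵥ (U.col j) = (ω * Complex.I) • X *ᵥ (U.col j) := by
  obtain ⟨V, hV, hVe⟩ := exists_unitary_mul_eq (P := X + F) (Q := X - F) (by
    rw [← sub_eq_zero]
    simp only [Matrix.conjTranspose_add, Matrix.conjTranspose_sub, Matrix.add_mul, Matrix.mul_add,
      Matrix.sub_mul, Matrix.mul_sub]
    rw [← smul_zero (2 : ℂ), ← h]
    module)
  obtain ⟨U, hU, hUe⟩ := exists_unitary_eigenvectors hV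
  refine ⟨U, hU, fun j => ?_⟩
  obtain ⟨z, hz, hVz⟩ := hUe j
  set w := U.col j
  have h1 : (1 + z) • F *ᵥ w = (z - 1) • X *ᵥ w := by
    have : (X + F) *ᵥ w = z • (X - F) *ᵥ w := by
      rw [hVe, ← Matrix.mulVec_mulVec, hVz, Matrix.mulVec_smul]
    rw [Matrix.add_mulVec, Matrix.sub_mulVec] at this
    ext i
    have := congrFun this i
    simp at this ⊢
    linear_combination this
  -- the eigenvalue `z = -1` stands for the infinite frequency
  by_cases hz1 : 1 + z = 0
  · left
    rw [hz1, zero_smul, eq_comm, smul_eq_zero] at h1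
    refine h1.resolve_left fun h => ?_
    have : (2 : ℂ) = 0 := by linear_combination hz1 - h
    norm_num at this
  · right
    refine ⟨((z - 1) / (1 + z)).im, ?_⟩
    have hre : ((z - 1) / (1 + z)).re = 0 := by
      have hzz : z.re * z.re + z.im * z.im = 1 := by
        rw [← Complex.normSq_apply, Complex.normSq_eq_norm_sq, hz]; simp
      rw [Complex.div_re]
      simp
      rw [← add_div]
      refine div_eq_zero_iff.2 (Or.inl ?_)
      linear_combination hzz
    have : (((z - 1) / (1 + z)).im : ℂ) * Complex.I = (z - 1) / (1 + z) := by
      conv_rhs => rw [← Complex.re_add_im ((z - 1) / (1 + z)), hre]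
      simp
    rw [this, div_eq_inv_mul, mul_smul, ← h1, smul_smul, inv_mul_cancel₀ hz1, one_smul]

end Unitary

/-! ### The Kalman–Yakubovich–Popov lemma -/

section Popov

variable {ι κ : Type*} [Fintype ι]

/-- The pair `(A, B)` is controllable: no proper `A`-invariant subspace contains the range
of `B`. -/
def IsControllable (A : Matrix ι ι ℂ) (B : Matrix ι κ ℂ) [Fintype κ] : Prop :=
  ∀ W : Submodule ℂ (ι → ℂ), (∀ x ∈ W, A *ᵥ x ∈ W) → (∀ u, B *ᵥ u ∈ W) → W = ⊤

/-- The pair `(C, A)` is observable: no nonzero `A`-invariant subspace lies in the kernel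
of `C`. -/
def IsObservable (C : Matrix κ ι ℂ) (A : Matrix ι ι ℂ) : Prop :=
  ∀ W : Submodule ℂ (ι → ℂ), (∀ x ∈ W, A *ᵥ x ∈ W) → (∀ x ∈ W, C *ᵥ x = 0) → W = ⊥

/-- The matrix of the Hermitian form `(x, u) ↦ 2 Re ⟨x, H (A x + B u)⟩`, the derivative of
`⟨x, H x⟩` along the solutions of `x' = A x + B u`, as a real linear function of `H`. -/
noncomputable def storageRate (A : Matrix ι ι ℂ) (B : Matrix ι κ ℂ) :
    Matrix ι ι ℂ →ₗ[ℝ] Matrix (ι ⊕ κ) (ι ⊕ κ) ℂ where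
  toFun H := Matrix.fromBlocks (H * A + Aᴴ * H) (H * B) (Bᴴ * H) 0
  map_add' H K := by
    rw [Matrix.fromBlocks_add]
    congr 1 <;> simp only [add_mul, mul_add, Matrix.add_mul, Matrix.mul_add, add_zero]
    abel
  map_smul' c H := by simp [Matrix.fromBlocks_smul]

theorem storageRate_apply (A : Matrix ι ι ℂ) (B : Matrix ι κ ℂ) (H : Matrix ι ι ℂ) :
    storageRate A B H = Matrix.fromBlocks (H * A + Aᴴ * H) (H * B) (Bᴴ * H) 0 := rfl

theorem isHermitian_storageRate (A : Matrix ι ι ℂ) (B : Matrix ι κ ℂ) {H : Matrix ι ι ℂ}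
    (hH : H.IsHermitian) : (storageRate A B H).IsHermitian := by
  rw [storageRate_apply, Matrix.isHermitian_fromBlocks_iff]
  refine ⟨?_, ?_, ?_, Matrix.isHermitian_zero⟩ <;>
    simp [Matrix.IsHermitian, Matrix.conjTranspose_mul, hH.eq, add_comm]

variable [Fintype κ]

theorem dotProduct_storageRate_mulVec (A : Matrix ι ι ℂ) (B : Matrix ι κ ℂ) (H : Matrix ι ι ℂ)
    (x : ι → ℂ) (u : κ → ℂ) :
    star (Sum.elim x u) ⬝ᵥ (storageRate A B H *ᵥ Sum.elim x u) =
      star x ⬝ᵥ (H *ᵥ (A *ᵥ x + B *ᵥ u)) + star (A *ᵥ x + B *ᵥ u) ⬝ᵥ (H *ᵥ x) := by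
  have hs : star (Sum.elim x u) = Sum.elim (star x) (star u) := by
    ext i; cases i <;> rfl
  rw [storageRate_apply, Matrix.fromBlocks_mulVec, hs, sumElim_dotProduct_sumElim]
  simp only [Sum.elim_comp_inl, Sum.elim_comp_inr, star_add, Matrix.star_mulVec, add_dotProduct,
    Matrix.add_mulVec, Matrix.mulVec_add, dotProduct_add, ← Matrix.mulVec_mulVec,
    Matrix.zero_mulVec, dotProduct_zero, ← Matrix.dotProduct_mulVec]
  ring

/-- For a controllable pair the cone of Hermitian `H` with nonincreasing storage for every input
is trivial: the kernel of `H` is an invariant subspace that contains the range of `B`. -/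
theorem eq_zero_of_posSemidef_neg_storageRate {A : Matrix ι ι ℂ} {B : Matrix ι κ ℂ}
    (hAB : IsControllable A B) {H : Matrix ι ι ℂ} (hH : H.IsHermitian)
    (h : (-storageRate A B H).PosSemidef) : H = 0 := by
  have hz : ∀ x u, star (Sum.elim x u) ⬝ᵥ (storageRate A B H *ᵥ Sum.elim x u) = 0 →
      (H * A + Aᴴ * H) *ᵥ x + (H * B) *ᵥ u = 0 := by
    intro x u hxu
    have h1 := (h.dotProduct_mulVec_zero_iff (Sum.elim x u)).1 (by
      rw [Matrix.neg_mulVec, dotProduct_neg, hxu, neg_zero])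
    rw [Matrix.neg_mulVec, neg_eq_zero, storageRate_apply, Matrix.fromBlocks_mulVec] at h1
    ext i
    simpa using congrFun h1 (Sum.inl i)
  have hker : LinearMap.ker (Matrix.mulVecLin H) = ⊤ := by
    refine hAB _ (fun x hx => ?_) fun u => ?_
    · rw [LinearMap.mem_ker, Matrix.mulVecLin_apply] at hx ⊢
      have h2 := hz x 0 (by
        rw [dotProduct_storageRate_mulVec, hx, Matrix.dotProduct_mulVec, ← hH.eq,
          ← Matrix.star_mulVec, hx]
        simp)
      rw [Matrix.add_mulVec, ← Matrix.mulVec_mulVec, ← Matrix.mulVec_mulVec, hx] at h2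
      simpa using h2
    · rw [LinearMap.mem_ker, Matrix.mulVecLin_apply]
      have h2 := hz 0 u (by rw [dotProduct_storageRate_mulVec]; simp)
      simpa [Matrix.mulVec_mulVec] using h2
  classical
  ext i j
  have : Pi.single j 1 ∈ LinearMap.ker (Matrix.mulVecLin H) := hker ▸ Submodule.mem_top
  rw [LinearMap.mem_ker, Matrix.mulVecLin_apply] at this
  simpa using congrFun this i

open scoped Matrix.Norms.Elementwise in
/-- The matrices `P + storageRate A B H` with `P` positive semidefinite and `H` Hermitian form a
closed set when `(A, B)` is controllable. -/
theorem isClosed_posSemidef_add_storageRate {A : Matrix ι ι ℂ} {B : Matrix ι κ ℂ}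
    (hAB : IsControllable A B) :
    IsClosed {M : Matrix (ι ⊕ κ) (ι ⊕ κ) ℂ | ∃ P H, P.PosSemidef ∧ H.IsHermitian ∧
      P + storageRate A B H = M} := by
  have : ProperSpace (Matrix (ι ⊕ κ) (ι ⊕ κ) ℂ × Matrix ι ι ℂ) := FiniteDimensional.proper ℝ _
  let f : (Matrix (ι ⊕ κ) (ι ⊕ κ) ℂ × Matrix ι ι ℂ) →L[ℝ] Matrix (ι ⊕ κ) (ι ⊕ κ) ℂ :=
    LinearMap.toContinuousLinearMap (LinearMap.id.coprod (storageRate A B))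
  let K : Set (Matrix (ι ⊕ κ) (ι ⊕ κ) ℂ × Matrix ι ι ℂ) := {p | p.1.PosSemidef ∧ p.2.IsHermitian}
  have hK : IsClosed K := by
    refine (isClosed_posSemidef.preimage continuous_fst).inter ?_
    exact isClosed_eq (f := fun p : Matrix (ι ⊕ κ) (ι ⊕ κ) ℂ × Matrix ι ι ℂ => p.2ᴴ)
      (by fun_prop) continuous_snd
  have himage := isClosed_image_of_cone f hK (fun c hc p hp => ?_) fun p hp hfp => ?_
  · convert! himage using 1
    ext M
    constructor
    · rintro ⟨P, H, hP, hH, rfl⟩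
      exact ⟨(P, H), ⟨hP, hH⟩, rfl⟩
    · rintro ⟨⟨P, H⟩, ⟨hP, hH⟩, rfl⟩
      exact ⟨P, H, hP, hH, rfl⟩
  · refine ⟨?_, hp.2.smul (.all c)⟩
    have : c • p.1 = (c : ℂ) • p.1 := by ext; simp
    rw [Prod.smul_fst, this]
    exact hp.1.smul (by exact_mod_cast hc.le)
  · have h1 : p.1 = -storageRate A B p.2 := eq_neg_of_add_eq_zero_left hfp
    have h2 := eq_zero_of_posSemidef_neg_storageRate hAB hp.2 (h1 ▸ hp.1)
    rw [h2, map_zero, neg_zero] at h1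
    exact Prod.ext h1 h2

open scoped MatrixOrder Matrix.Norms.L2Operator in
theorem exists_eq_mul_conjTranspose_of_posSemidef [DecidableEq ι] {Z : Matrix ι ι ℂ}
    (hZ : Z.PosSemidef) : ∃ W : Matrix ι ι ℂ, Z = W * Wᴴ := by
  obtain ⟨W, hW⟩ := CStarAlgebra.nonneg_iff_eq_star_mul_self.mp hZ.nonneg
  exact ⟨Wᴴ, by rw [hW, Matrix.conjTranspose_conjTranspose]; rfl⟩

/-- The trace of `W Wᴴ M` is the sum of the values of the form `M` on the columns of `W U`, for
any unitary `U`. -/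
theorem trace_mul_eq_sum_col [DecidableEq κ] (W : Matrix ι κ ℂ) {U : Matrix κ κ ℂ}
    (hU : U * Uᴴ = 1) (M : Matrix ι ι ℂ) :
    (W * Wᴴ * M).trace = ∑ j, star (W *ᵥ U.col j) ⬝ᵥ (M *ᵥ (W *ᵥ U.col j)) := by
  have h1 : W * Wᴴ = (W * U) * (W * U)ᴴ := by
    rw [Matrix.conjTranspose_mul, Matrix.mul_assoc W U, ← Matrix.mul_assoc U, hU, Matrix.one_mul]
  have h2 : ∀ j, W *ᵥ U.col j = (W * U).col j := fun j => rfl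
  rw [h1, Matrix.mul_assoc, Matrix.trace_mul_comm, Matrix.trace]
  refine Finset.sum_congr rfl fun j _ => ?_
  rw [h2, Matrix.diag_apply, Matrix.mul_assoc]
  rfl

open scoped Matrix.Norms.Elementwise in
/-- **Kalman–Yakubovich–Popov lemma**, nonstrict form for a controllable pair. If the Hermitian
form `N` is nonnegative on all `(x, u)` with `i ω x = A x + B u` for some real `ω`, and on all
`(0, u)`, then `N - storageRate A B H` is positive semidefinite for some Hermitian `H`. Otherwise
a hyperplane separates `N` from the closed cone of all `P + storageRate A B H`; it is the trace
against some `Z = W Wᴴ`, and by `exists_unitary_of_skew` the columns of `W` can be chosen among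
the pairs `(x, u)` on which `N` is nonnegative. -/
theorem exists_posSemidef_sub_storageRate [DecidableEq ι] [DecidableEq κ]
    {A : Matrix ι ι ℂ} {B : Matrix ι κ ℂ}
    (hAB : IsControllable A B) {N : Matrix (ι ⊕ κ) (ι ⊕ κ) ℂ} (hN : N.IsHermitian)
    (hfreq : ∀ x u, (x = 0 ∨ ∃ ω : ℝ, A *ᵥ x + B *ᵥ u = (ω * Complex.I) • x) →
      0 ≤ star (Sum.elim x u) ⬝ᵥ (N *ᵥ Sum.elim x u)) :
    ∃ H : Matrix ι ι ℂ, H.IsHermitian ∧ (N - storageRate A B H).PosSemidef := by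
  by_contra hcon
  push Not at hcon
  set K := {M : Matrix (ι ⊕ κ) (ι ⊕ κ) ℂ | ∃ P H, P.PosSemidef ∧ H.IsHermitian ∧
      P + storageRate A B H = M} with hK
  have hNK : N ∉ K := by
    rintro ⟨P, H, hP, hH, rfl⟩
    exact hcon H hH (by simpa using hP)
  have hsmulK : ∀ c : ℝ, 0 ≤ c → ∀ M ∈ K, c • M ∈ K := by
    rintro c hc _ ⟨P, H, hP, hH, rfl⟩
    refine ⟨c • P, c • H, ?_, hH.smul (.all c), by simp⟩
    have : c • P = (c : ℂ) • P := by ext; simp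
    exact this ▸ hP.smul (by exact_mod_cast hc)
  have haddK : ∀ M ∈ K, ∀ M' ∈ K, M + M' ∈ K := by
    rintro _ ⟨P, H, hP, hH, rfl⟩ _ ⟨P', H', hP', hH', rfl⟩
    exact ⟨P + P', H + H', hP.add hP', hH.add hH', by rw [map_add]; abel⟩
  have hconv : Convex ℝ K := fun M hM M' hM' a b ha hb _ =>
    haddK _ (hsmulK a ha M hM) _ (hsmulK b hb M' hM')
  have : LocallyConvexSpace ℝ (Matrix (ι ⊕ κ) (ι ⊕ κ) ℂ) := NormedSpace.toLocallyConvexSpace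
  obtain ⟨f, c, hNc, hcK⟩ := geometric_hahn_banach_point_closed hconv
    (isClosed_posSemidef_add_storageRate hAB) hNK
  have hc : c < 0 := by
    simpa using hcK 0 ⟨0, 0, .zero, Matrix.isHermitian_zero, by simp⟩
  have hfK : ∀ M ∈ K, 0 ≤ f M := by
    intro M hM
    by_contra! hneg
    have := hcK _ (hsmulK (c / f M) (div_nonneg_of_nonpos hc.le hneg.le) M hM)
    rw [map_smul, smul_eq_mul, div_mul_cancel₀ _ hneg.ne] at this
    exact lt_irrefl _ this
  obtain ⟨Z, hZ, hfZ⟩ := exists_isHermitian_trace_eq f.toLinearMap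
  have hZpos : Z.PosSemidef := by
    refine Matrix.PosSemidef.of_dotProduct_mulVec_nonneg hZ fun z => ?_
    have hz : (Matrix.vecMulVec z (star z)).PosSemidef := Matrix.posSemidef_vecMulVec_self_star z
    have h1 := hfK _ ⟨_, 0, hz, Matrix.isHermitian_zero, by rw [map_zero, add_zero]⟩
    have h2 := hfZ _ hz.isHermitian
    rw [Matrix.mul_vecMulVec, Matrix.trace_vecMulVec, dotProduct_comm] at h2
    refine Complex.le_def.2 ⟨?_, (hZ.im_star_dotProduct_mulVec_self z).symm⟩
    simp only [ContinuousLinearMap.coe_coe] at h2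
    rwa [Complex.zero_re, ← h2]
  obtain ⟨W, hW'⟩ := exists_eq_mul_conjTranspose_of_posSemidef hZpos
  set X := W.toRows₁ with hX
  set Y := W.toRows₂ with hY
  set F := A * X + B * Y with hF
  have hskew : X * Fᴴ + F * Xᴴ = 0 := by
    set S := X * Fᴴ + F * Xᴴ with hS
    have hSH : S.IsHermitian := by
      simp [Matrix.IsHermitian, hS, add_comm]
    have hf0 : f (storageRate A B S) = 0 := by
      refine le_antisymm ?_ (hfK _ ⟨0, S, .zero, hSH, by simp⟩)
      have := hfK _ ⟨0, -S, .zero, hSH.neg, rfl⟩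
      simpa using this
    have h1 := hfZ _ (isHermitian_storageRate A B hSH)
    have h2 : (Z * storageRate A B S).trace = (S * Sᴴ).trace := by
      have hWrows : W = Matrix.fromRows X Y := (Matrix.fromRows_toRows W).symm
      have h3 : Wᴴ * (storageRate A B S * W) = Fᴴ * (S * X) + Xᴴ * (S * F) := by
        rw [hWrows, storageRate_apply, Matrix.fromBlocks_mul_fromRows,
          Matrix.conjTranspose_fromRows_eq_fromCols_conjTranspose, Matrix.fromCols_mul_fromRows]
        simp only [hF, Matrix.conjTranspose_add, Matrix.conjTranspose_mul, Matrix.add_mul,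
          Matrix.mul_add, Matrix.mul_assoc, Matrix.zero_mul, add_zero]
        abel
      rw [hSH.eq, hW', Matrix.mul_assoc, Matrix.trace_mul_comm, Matrix.mul_assoc, h3,
        Matrix.trace_add, Matrix.trace_mul_comm Fᴴ, Matrix.trace_mul_comm Xᴴ, ← Matrix.trace_add,
        Matrix.mul_assoc, Matrix.mul_assoc, ← Matrix.mul_add]
    simp only [ContinuousLinearMap.coe_coe] at h1
    rw [hf0, h2] at h1
    have hSS := Matrix.posSemidef_self_mul_conjTranspose S
    rw [← Matrix.trace_mul_conjTranspose_self_eq_zero_iff]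
    exact Complex.ext h1.symm (Complex.le_def.1 hSS.trace_nonneg).2.symm
  obtain ⟨U, hU, hUc⟩ := exists_unitary_of_skew hskew
  have hNpos : 0 ≤ (Z * N).trace := by
    rw [hW', trace_mul_eq_sum_col W hU]
    refine Finset.sum_nonneg fun j _ => ?_
    have hsplit : W *ᵥ U.col j = Sum.elim (X *ᵥ U.col j) (Y *ᵥ U.col j) := by
      ext i; cases i <;> rfl
    rw [hsplit]
    refine hfreq _ _ ((hUc j).imp id fun ⟨ω, hω⟩ => ⟨ω, ?_⟩)
    rw [← hω, hF, Matrix.add_mulVec, Matrix.mulVec_mulVec, Matrix.mulVec_mulVec]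
  have h3 := hfZ N hN
  have h4 := (Complex.le_def.1 hNpos).1
  simp only [ContinuousLinearMap.coe_coe, Complex.zero_re] at h3 h4
  linarith

end Popov

/-! ### Realizations of rational matrix functions -/

/-- The matrix `s I - A` over the field of rational functions is the characteristic matrix. -/
theorem scalar_X_sub_map_C {n : ℕ} (A : Matrix (Fin n) (Fin n) ℂ) :
    Matrix.scalar (Fin n) (RatFunc.X : RatFunc ℂ) - A.map RatFunc.C =
      A.charmatrix.map (algebraMap (Polynomial ℂ) (RatFunc ℂ)) := by
  ext i j
  by_cases h : i = j
  · subst h; simp [Matrix.charmatrix_apply_eq]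
  · simp [h]

theorem isUnit_det_scalar_X_sub_map_C {n : ℕ} (A : Matrix (Fin n) (Fin n) ℂ) :
    IsUnit (Matrix.scalar (Fin n) (RatFunc.X : RatFunc ℂ) - A.map RatFunc.C).det := by
  have : (A.charmatrix.map (algebraMap (Polynomial ℂ) (RatFunc ℂ))).det =
      algebraMap (Polynomial ℂ) (RatFunc ℂ) A.charpoly :=
    ((algebraMap (Polynomial ℂ) (RatFunc ℂ)).map_det A.charmatrix).symm
  rw [scalar_X_sub_map_C, this, isUnit_iff_ne_zero]
  exact RatFunc.algebraMap_ne_zero A.charpoly_monic.ne_zero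

/-- Evaluation of a fraction `p / q`, not assumed to be in lowest terms, where `q ≠ 0`. -/
theorem ratFunc_eval_of_mul_eq {f : RatFunc ℂ} {p q : Polynomial ℂ} (hq : q ≠ 0)
    (h : algebraMap _ (RatFunc ℂ) q * f = algebraMap _ (RatFunc ℂ) p) {s : ℂ}
    (hs : q.eval s ≠ 0) :
    f.denom.eval s ≠ 0 ∧ q.eval s * f.eval (RingHom.id ℂ) s = p.eval s := by
  have hf : f = algebraMap _ (RatFunc ℂ) p / algebraMap _ (RatFunc ℂ) q := by
    rw [eq_div_iff (RatFunc.algebraMap_ne_zero hq), mul_comm, h]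
  have hd : f.denom.eval s ≠ 0 := by
    obtain ⟨r, hr⟩ : f.denom ∣ q := hf ▸ RatFunc.denom_div_dvd p q
    rw [hr, Polynomial.eval_mul] at hs
    exact left_ne_zero_of_mul hs
  refine ⟨hd, ?_⟩
  have := RatFunc.eval_mul (f := RingHom.id ℂ) (a := s) (x := algebraMap _ (RatFunc ℂ) q) (y := f)
    (by simp) hd
  rw [h] at this
  simpa [RatFunc.eval_algebraMap, Polynomial.eval₂_id] using this.symm

/-- Away from the eigenvalues of `A` the rational function realized by `(A, B, C, D)` is analytic,
and its value is `C (s - A)⁻¹ B + D`. -/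
theorem IsRealization.isAnalyticAt_and_evalAt {m n : ℕ} {G : RatMatrix m}
    {A : Matrix (Fin n) (Fin n) ℂ} {B : Matrix (Fin n) (Fin m) ℂ} {C : Matrix (Fin m) (Fin n) ℂ}
    {D : Matrix (Fin m) (Fin m) ℂ} (h : IsRealization G A B C D) {s : ℂ}
    (hs : IsUnit (s • (1 : Matrix (Fin n) (Fin n) ℂ) - A).det) :
    IsAnalyticAt G s ∧ evalAt G s = C * (s • (1 : Matrix (Fin n) (Fin n) ℂ) - A)⁻¹ * B + D := by
  set φ := algebraMap (Polynomial ℂ) (RatFunc ℂ)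
  -- `G = P / det (s - A)` with the polynomial numerator `P` given by the adjugate
  let P : Matrix (Fin m) (Fin m) (Polynomial ℂ) :=
    C.map Polynomial.C * A.charmatrix.adjugate * B.map Polynomial.C +
      A.charpoly • D.map Polynomial.C
  have hφC : ∀ {k l : ℕ} (M : Matrix (Fin k) (Fin l) ℂ),
      (M.map Polynomial.C).map φ = M.map RatFunc.C := by
    intro k l M; ext i j; simp [φ]
  have hdet : (A.charmatrix.map φ).det = φ A.charpoly := (φ.map_det A.charmatrix).symm
  have hadj : (A.charmatrix.map φ).adjugate = A.charmatrix.adjugate.map φ :=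
    (φ.map_adjugate A.charmatrix).symm
  have hq0 : φ A.charpoly ≠ 0 := RatFunc.algebraMap_ne_zero A.charpoly_monic.ne_zero
  have hG : φ A.charpoly • G = P.map φ := by
    rw [h, scalar_X_sub_map_C, Matrix.inv_def, hadj, hdet, Ring.inverse_eq_inv', Matrix.mul_smul,
      Matrix.smul_mul, smul_add, smul_smul, mul_inv_cancel₀ hq0, one_smul,
      Matrix.map_add _ (map_add φ), Matrix.map_mul, Matrix.map_mul, hφC, hφC]
    congr 1
    ext i j
    simp [φ]
  have hscalar : Matrix.scalar (Fin n) s - A = s • (1 : Matrix (Fin n) (Fin n) ℂ) - A := by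
    rw [Matrix.scalar_apply, Matrix.smul_one_eq_diagonal]
  have hqs : A.charpoly.eval s = (s • (1 : Matrix (Fin n) (Fin n) ℂ) - A).det := by
    rw [Matrix.eval_charpoly, hscalar]
  have hentry := fun i j => ratFunc_eval_of_mul_eq (f := G i j) (p := P i j)
    A.charpoly_monic.ne_zero
    (congrFun (congrFun hG i) j) (hqs ▸ hs.ne_zero)
  refine ⟨fun i j => (hentry i j).1, ?_⟩
  have heval : (s • (1 : Matrix (Fin n) (Fin n) ℂ) - A).det • evalAt G s =
      P.map (Polynomial.evalRingHom s) := by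
    ext i j
    simpa [evalAt, hqs] using (hentry i j).2
  have hC : ∀ {k l : ℕ} (M : Matrix (Fin k) (Fin l) ℂ),
      (M.map Polynomial.C).map (Polynomial.evalRingHom s) = M := by
    intro k l M; ext i j; simp
  have hadj' : A.charmatrix.adjugate.map (Polynomial.evalRingHom s) =
      (s • (1 : Matrix (Fin n) (Fin n) ℂ) - A).adjugate := by
    have h1 := (Polynomial.evalRingHom s).map_adjugate A.charmatrix
    rw [RingHom.mapMatrix_apply, RingHom.mapMatrix_apply] at h1
    rw [h1, ← hscalar]
    congr 1
    ext i j
    by_cases hij : i = j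
    · subst hij; simp [Matrix.charmatrix_apply_eq]
    · simp [hij]
  have hP : P.map (Polynomial.evalRingHom s) =
      C * (s • (1 : Matrix (Fin n) (Fin n) ℂ) - A).adjugate * B +
        (s • (1 : Matrix (Fin n) (Fin n) ℂ) - A).det • D := by
    rw [Matrix.map_add _ (map_add _), Matrix.map_mul, Matrix.map_mul, hC, hC, hadj']
    congr 1
    ext i j
    simp [hqs]
  rw [hP] at heval
  have := congrArg (fun M => (s • (1 : Matrix (Fin n) (Fin n) ℂ) - A).det⁻¹ • M) heval
  simp only [smul_add, smul_smul, inv_mul_cancel₀ hs.ne_zero, one_smul] at this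
  rw [this, Matrix.inv_def, Ring.inverse_eq_inv', Matrix.mul_smul, Matrix.smul_mul]

section Minimality

variable {m n r : ℕ} {G : RatMatrix m} {A : Matrix (Fin n) (Fin n) ℂ}
  {B : Matrix (Fin n) (Fin m) ℂ} {C : Matrix (Fin m) (Fin n) ℂ} {D : Matrix (Fin m) (Fin m) ℂ}

/-- If `T` intertwines two state matrices then it intertwines their resolvents. -/
theorem resolvent_mul_map_C {A₁ : Matrix (Fin r) (Fin r) ℂ} {T : Matrix (Fin n) (Fin r) ℂ}
    (hT : A * T = T * A₁) :
    (Matrix.scalar (Fin n) (RatFunc.X : RatFunc ℂ) - A.map RatFunc.C)⁻¹ * T.map RatFunc.C =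
      T.map RatFunc.C *
        (Matrix.scalar (Fin r) (RatFunc.X : RatFunc ℂ) - A₁.map RatFunc.C)⁻¹ := by
  set R := Matrix.scalar (Fin n) (RatFunc.X : RatFunc ℂ) - A.map RatFunc.C with hR
  set R₁ := Matrix.scalar (Fin r) (RatFunc.X : RatFunc ℂ) - A₁.map RatFunc.C with hR₁
  have hRT : R * T.map RatFunc.C = T.map RatFunc.C * R₁ := by
    rw [hR, hR₁, Matrix.sub_mul, Matrix.mul_sub, ← Matrix.map_mul, ← Matrix.map_mul, hT]
    congr 1
    ext i j
    simp [Matrix.scalar_apply, mul_comm]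
  calc R⁻¹ * T.map RatFunc.C = R⁻¹ * (T.map RatFunc.C * R₁) * R₁⁻¹ := by
        rw [Matrix.mul_assoc, Matrix.mul_assoc,
          Matrix.mul_nonsing_inv _ (isUnit_det_scalar_X_sub_map_C A₁), Matrix.mul_one]
    _ = T.map RatFunc.C * R₁⁻¹ := by
        rw [← hRT, ← Matrix.mul_assoc R⁻¹,
          Matrix.nonsing_inv_mul _ (isUnit_det_scalar_X_sub_map_C A), Matrix.one_mul]

/-- The state space of a realization can be cut down to an invariant subspace, the range of `T`,
that contains the range of the input matrix. -/
theorem IsRealization.restrict {A₁ : Matrix (Fin r) (Fin r) ℂ} {B₁ : Matrix (Fin r) (Fin m) ℂ}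
    {T : Matrix (Fin n) (Fin r) ℂ} (hT : A * T = T * A₁) (h : IsRealization G A (T * B₁) C D) :
    IsRealization G A₁ B₁ (C * T) D := by
  rw [IsRealization, h, Matrix.map_mul, Matrix.map_mul, Matrix.mul_assoc, Matrix.mul_assoc,
    ← Matrix.mul_assoc _ (T.map _), resolvent_mul_map_C hT]
  simp only [Matrix.mul_assoc]

/-- An invariant subspace, the kernel of `S`, on which the output matrix vanishes can be divided
out of the state space of a realization. -/
theorem IsRealization.quotient {A₁ : Matrix (Fin r) (Fin r) ℂ} {C₁ : Matrix (Fin m) (Fin r) ℂ}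
    {S : Matrix (Fin r) (Fin n) ℂ} (hS : A₁ * S = S * A) (h : IsRealization G A B (C₁ * S) D) :
    IsRealization G A₁ (S * B) C₁ D := by
  rw [IsRealization, h, Matrix.map_mul, Matrix.map_mul, Matrix.mul_assoc, Matrix.mul_assoc,
    ← Matrix.mul_assoc (S.map _), ← resolvent_mul_map_C hS]
  simp only [Matrix.mul_assoc]

theorem mcMillanDegree_le (h : IsRealization G A B C D) : mcMillanDegree G ≤ n :=
  Nat.sInf_le ⟨A, B, C, D, h⟩

/-- A realization of least dimension is controllable: otherwise it could be restricted to a proper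
invariant subspace. -/
theorem IsRealization.isControllable (h : IsRealization G A B C D) (hn : mcMillanDegree G = n) :
    IsControllable A B := by
  intro W hA hB
  by_contra hW
  obtain ⟨r, hr, ⟨e⟩⟩ : ∃ r < n, Nonempty (W ≃ₗ[ℂ] (Fin r → ℂ)) :=
    ⟨Module.finrank ℂ W, by simpa using Submodule.finrank_lt hW,
      ⟨(Module.finBasis ℂ W).equivFun⟩⟩
  let T := LinearMap.toMatrix' (W.subtype ∘ₗ e.symm.toLinearMap)
  let A₁ := LinearMap.toMatrix' (e.toLinearMap ∘ₗ
    (A.mulVecLin.restrict (p := W) (q := W) hA) ∘ₗ e.symm.toLinearMap)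
  let B₁ := LinearMap.toMatrix' (e.toLinearMap ∘ₗ (B.mulVecLin.codRestrict W hB))
  have hT : A * T = T * A₁ := by
    apply Matrix.toLin'.injective
    rw [Matrix.toLin'_mul, Matrix.toLin'_mul]
    simp only [T, A₁, Matrix.toLin'_toMatrix']
    ext x i
    simp
    rfl
  have hB₁ : B = T * B₁ := by
    apply Matrix.toLin'.injective
    rw [Matrix.toLin'_mul]
    simp only [T, B₁, Matrix.toLin'_toMatrix']
    ext x i
    simp only [LinearMap.comp_apply, Matrix.toLin'_apply, LinearEquiv.coe_coe,
      LinearEquiv.symm_apply_apply]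
    rfl
  rw [hB₁] at h
  exact absurd (hn.symm.le.trans (mcMillanDegree_le (h.restrict hT))) (not_le.2 hr)

/-- A realization of least dimension is observable: otherwise a nonzero invariant subspace could be
divided out. -/
theorem IsRealization.isObservable (h : IsRealization G A B C D) (hn : mcMillanDegree G = n) :
    IsObservable C A := by
  intro W hA hC
  by_contra hW
  obtain ⟨r, hr, ⟨e⟩⟩ : ∃ r < n, Nonempty (((Fin n → ℂ) ⧸ W) ≃ₗ[ℂ] (Fin r → ℂ)) := by
    refine ⟨Module.finrank ℂ ((Fin n → ℂ) ⧸ W), ?_, ⟨(Module.finBasis ℂ _).equivFun⟩⟩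
    have h1 := Submodule.finrank_quotient_add_finrank W
    have h2 : 0 < Module.finrank ℂ W :=
      Nat.pos_of_ne_zero fun h0 => hW (Submodule.finrank_eq_zero.1 h0)
    rw [Module.finrank_fin_fun] at h1
    omega
  let S := LinearMap.toMatrix' (e.toLinearMap ∘ₗ W.mkQ)
  let A₁ := LinearMap.toMatrix' (e.toLinearMap ∘ₗ (W.mapQ W A.mulVecLin hA) ∘ₗ e.symm.toLinearMap)
  let C₁ := LinearMap.toMatrix' ((W.liftQ C.mulVecLin hC) ∘ₗ e.symm.toLinearMap)
  have hS : A₁ * S = S * A := by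
    apply Matrix.toLin'.injective
    rw [Matrix.toLin'_mul, Matrix.toLin'_mul]
    simp only [S, A₁, Matrix.toLin'_toMatrix']
    ext x i
    simp only [LinearMap.comp_apply, Matrix.toLin'_apply, LinearEquiv.coe_coe,
      LinearEquiv.symm_apply_apply]
    rfl
  have hC₁ : C = C₁ * S := by
    apply Matrix.toLin'.injective
    rw [Matrix.toLin'_mul]
    simp only [S, C₁, Matrix.toLin'_toMatrix']
    ext x i
    simp only [LinearMap.comp_apply, Matrix.toLin'_apply, LinearEquiv.coe_coe,
      LinearEquiv.symm_apply_apply]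
    rfl
  rw [hC₁] at h
  exact absurd (hn.symm.le.trans (mcMillanDegree_le (h.quotient hS))) (not_le.2 hr)

end Minimality

/-! ### Contractive transfer functions -/

section Transfer

variable {ι κ : Type*} [Fintype ι] [DecidableEq ι] [Fintype κ]

/-- The transfer function `C (s - A)⁻¹ B + D` of the system `(A, B, C, D)`; its value is
meaningful where `s` is not an eigenvalue of `A`. -/
noncomputable def transfer (A : Matrix ι ι ℂ) (B : Matrix ι κ ℂ) (C : Matrix κ ι ℂ)
    (D : Matrix κ κ ℂ) (s : ℂ) : Matrix κ κ ℂ :=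
  C * (s • (1 : Matrix ι ι ℂ) - A)⁻¹ * B + D

theorem transfer_mulVec (A : Matrix ι ι ℂ) (B : Matrix ι κ ℂ) (C : Matrix κ ι ℂ)
    (D : Matrix κ κ ℂ) (s : ℂ) (u : κ → ℂ) :
    transfer A B C D s *ᵥ u =
      C *ᵥ ((s • (1 : Matrix ι ι ℂ) - A)⁻¹ *ᵥ (B *ᵥ u)) + D *ᵥ u := by
  rw [transfer, Matrix.add_mulVec, Matrix.mulVec_mulVec, Matrix.mulVec_mulVec, Matrix.mul_assoc]

variable [DecidableEq κ]

/-- At every point of the open right half plane that is not an eigenvalue of `A`, the transfer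
function `T` satisfies `w Tᴴ T ≤ 1`. -/
def IsContractive (w : ℝ) (A : Matrix ι ι ℂ) (B : Matrix ι κ ℂ) (C : Matrix κ ι ℂ)
    (D : Matrix κ κ ℂ) : Prop :=
  ∀ s : ℂ, 0 < s.re → IsUnit (s • (1 : Matrix ι ι ℂ) - A).det →
    (1 - (w : ℂ) • ((transfer A B C D s)ᴴ * transfer A B C D s)).PosSemidef

theorem dotProduct_one_sub_smul_mulVec (w : ℂ) (T : Matrix κ κ ℂ) (u : κ → ℂ) :
    star u ⬝ᵥ ((1 - w • (Tᴴ * T)) *ᵥ u) = star u ⬝ᵥ u - w * (star (T *ᵥ u) ⬝ᵥ (T *ᵥ u)) := by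
  rw [Matrix.sub_mulVec, Matrix.one_mulVec, dotProduct_sub, Matrix.smul_mulVec, dotProduct_smul,
    ← Matrix.mulVec_mulVec, Matrix.star_mulVec, ← Matrix.dotProduct_mulVec, smul_eq_mul]

/-- A matrix `T` with `w Tᴴ T ≤ 1` maps a given vector to vectors bounded independently
of `T`. -/
theorem norm_mulVec_le_of_posSemidef {w : ℝ} (hw : 0 < w) {T : Matrix κ κ ℂ}
    (hT : (1 - (w : ℂ) • (Tᴴ * T)).PosSemidef) (u : κ → ℂ) :
    ‖T *ᵥ u‖ ≤ 1 + (star u ⬝ᵥ u).re / w := by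
  have hnn : ∀ v : κ → ℂ, (star v ⬝ᵥ v).re = ∑ i, ‖v i‖ ^ 2 := by
    intro v
    rw [dotProduct, Complex.re_sum]
    refine Finset.sum_congr rfl fun i _ => ?_
    rw [Pi.star_apply, Complex.star_def, ← Complex.normSq_eq_conj_mul_self, Complex.ofReal_re,
      Complex.normSq_eq_norm_sq]
  have h := (Complex.le_def.1 (hT.dotProduct_mulVec_nonneg u)).1
  rw [dotProduct_one_sub_smul_mulVec, Complex.sub_re, Complex.re_ofReal_mul, Complex.zero_re,
    hnn (T *ᵥ u)] at h
  have h1 : ∑ i, ‖(T *ᵥ u) i‖ ^ 2 ≤ (star u ⬝ᵥ u).re / w := by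
    rw [le_div_iff₀ hw]; linarith
  have h0 : 0 ≤ (star u ⬝ᵥ u).re / w :=
    (Finset.sum_nonneg fun i _ => by positivity).trans h1
  refine (pi_norm_le_iff_of_nonneg (by linarith)).2 fun i => ?_
  have h2 : ‖(T *ᵥ u) i‖ ^ 2 ≤ ∑ i, ‖(T *ᵥ u) i‖ ^ 2 :=
    Finset.single_le_sum (f := fun i => ‖(T *ᵥ u) i‖ ^ 2) (fun i _ => by positivity)
      (Finset.mem_univ i)
  -- `a ≤ 1 + a ^ 2`
  nlinarith [sq_nonneg (‖(T *ᵥ u) i‖ - 1)]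

/-- The eigenvalues of `A` are isolated. -/
theorem eventually_isUnit_det (A : Matrix ι ι ℂ) (lam : ℂ) :
    ∀ᶠ t : ℝ in 𝓝[>] 0, IsUnit ((lam + t) • (1 : Matrix ι ι ℂ) - A).det := by
  have hfin : {t : ℝ | A.charpoly.IsRoot (lam + t)}.Finite :=
    (Polynomial.finite_setOfPred_isRoot A.charpoly_monic.ne_zero).preimage
      (f := fun t : ℝ => lam + t) (fun a _ b _ h => by simpa using h)
  have h1 : ({t : ℝ | A.charpoly.IsRoot (lam + t)} \ {0})ᶜ ∈ 𝓝 (0 : ℝ) :=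
    hfin.sdiff.isClosed.isOpen_compl.mem_nhds (by simp)
  filter_upwards [mem_nhdsWithin_of_mem_nhds h1, self_mem_nhdsWithin] with t ht ht0
  rw [isUnit_iff_ne_zero]
  intro h
  refine ht ⟨?_, ne_of_gt ht0⟩
  rw [Set.mem_ofPred_eq, Polynomial.IsRoot, Matrix.eval_charpoly, ← h, Matrix.scalar_apply,
    Matrix.smul_one_eq_diagonal]

/-- The state matrix of a minimal system with contractive transfer function has no eigenvalue in
the closed right half plane. Near an eigenvalue `lam`, the vectors `v` for which `C (s - A)⁻¹ v`
stays bounded form an invariant subspace that contains the range of `B`, so they are all vectors;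
for an eigenvector `v` this forces `C v = 0`, against observability. -/
theorem IsContractive.isUnit_det {w : ℝ} (hw : 0 < w) {A : Matrix ι ι ℂ} {B : Matrix ι κ ℂ}
    {C : Matrix κ ι ℂ} {D : Matrix κ κ ℂ} (hT : IsContractive w A B C D)
    (hAB : IsControllable A B) (hCA : IsObservable C A) (lam : ℂ) (hlam : 0 ≤ lam.re) :
    IsUnit (lam • (1 : Matrix ι ι ℂ) - A).det := by
  rw [isUnit_iff_ne_zero]
  intro hdet
  obtain ⟨v, hv, hAv⟩ := Matrix.exists_mulVec_eq_zero_iff.2 hdet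
  replace hAv : A *ᵥ v = lam • v := by
    rw [Matrix.sub_mulVec, Matrix.smul_mulVec, Matrix.one_mulVec, sub_eq_zero] at hAv
    exact hAv.symm
  let R : ℝ → Matrix ι ι ℂ := fun t => ((lam + t) • (1 : Matrix ι ι ℂ) - A)⁻¹
  have hR : ∀ᶠ t : ℝ in 𝓝[>] 0, R t * ((lam + t) • (1 : Matrix ι ι ℂ) - A) = 1 := by
    filter_upwards [eventually_isUnit_det A lam] with t ht
    exact Matrix.nonsing_inv_mul _ ht
  let W : Submodule ℂ (ι → ℂ) :=
    { carrier := {x | (fun t => C *ᵥ (R t *ᵥ x)) =O[𝓝[>] (0 : ℝ)] fun _ => (1 : ℝ)}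
      zero_mem' := by
        simp only [Set.mem_ofPred_eq, Matrix.mulVec_zero]
        exact Asymptotics.isBigO_zero _ _
      add_mem' := fun {x y} hx hy => by
        simpa only [Set.mem_ofPred_eq, Matrix.mulVec_add] using hx.add hy
      smul_mem' := fun c x hx => by
        simp only [Set.mem_ofPred_eq, Matrix.mulVec_smul]
        exact hx.const_smul_left c }
  have hWmem : ∀ x, x ∈ W ↔ (fun t => C *ᵥ (R t *ᵥ x)) =O[𝓝[>] (0 : ℝ)] fun _ => (1 : ℝ) :=
    fun x => Iff.rfl
  have hW : W = ⊤ := by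
    refine hAB W (fun x hx => ?_) fun u => ?_
    · rw [hWmem] at hx ⊢
      have hlim : (fun t : ℝ => lam + t) =O[𝓝[>] (0 : ℝ)] fun _ => (1 : ℝ) := by
        have : Tendsto (fun t : ℝ => lam + t) (𝓝[>] 0) (𝓝 (lam + (0 : ℝ))) :=
          (Continuous.tendsto (by fun_prop) 0).mono_left nhdsWithin_le_nhds
        exact this.isBigO_one ℝ
      have h0 := hlim.smul hx
      simp only [smul_eq_mul, mul_one] at h0
      have h1 := h0.sub
        (Asymptotics.isBigO_const_const (C *ᵥ x) (one_ne_zero (α := ℝ)) (𝓝[>] (0 : ℝ)))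
      refine h1.congr' ?_ .rfl
      filter_upwards [hR] with t ht
      have h2 : R t *ᵥ (A *ᵥ x) = (lam + t) • R t *ᵥ x - x := by
        have h3 := congrArg (· *ᵥ x) ht
        simp only [← Matrix.mulVec_mulVec, Matrix.sub_mulVec, Matrix.smul_mulVec,
          Matrix.one_mulVec, Matrix.mulVec_sub, Matrix.mulVec_smul] at h3
        rw [eq_sub_iff_add_eq', ← eq_sub_iff_add_eq, h3]
      rw [h2, Matrix.mulVec_sub, Matrix.mulVec_smul]
    · rw [hWmem]
      refine Asymptotics.IsBigO.of_bound (1 + (star u ⬝ᵥ u).re / w + ‖D *ᵥ u‖) ?_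
      filter_upwards [eventually_isUnit_det A lam, self_mem_nhdsWithin] with t ht ht0
      have hre : 0 < (lam + t).re := by
        rw [Complex.add_re, Complex.ofReal_re]
        exact add_pos_of_nonneg_of_pos hlam ht0
      have h1 := norm_mulVec_le_of_posSemidef hw (hT _ hre ht) u
      have h2 : C *ᵥ (R t *ᵥ (B *ᵥ u)) = transfer A B C D (lam + t) *ᵥ u - D *ᵥ u := by
        rw [transfer_mulVec, add_sub_cancel_right]
      rw [h2, norm_one, mul_one]
      exact (norm_sub_le _ _).trans (by linarith)
  have hCv : C *ᵥ v = 0 := by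
    have h1 : (fun t => C *ᵥ (R t *ᵥ v)) =O[𝓝[>] (0 : ℝ)] fun _ => (1 : ℝ) :=
      (hWmem v).1 (hW ▸ Submodule.mem_top)
    have h2 := (Asymptotics.isBigO_refl (fun t : ℝ => t) (𝓝[>] (0 : ℝ))).smul h1
    have h3 : (fun _ : ℝ => C *ᵥ v) =O[𝓝[>] (0 : ℝ)] fun t : ℝ => t := by
      simp only [smul_eq_mul, mul_one] at h2
      refine h2.congr' ?_ .rfl
      filter_upwards [hR] with t ht
      have h4 := congrArg (· *ᵥ v) ht
      have h5 : ((lam + t) • (1 : Matrix ι ι ℂ) - A) *ᵥ v = (t : ℂ) • v := by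
        rw [Matrix.sub_mulVec, Matrix.smul_mulVec, Matrix.one_mulVec, hAv, add_smul,
          add_sub_cancel_left]
      simp only [← Matrix.mulVec_mulVec, h5, Matrix.one_mulVec, Matrix.mulVec_smul] at h4
      rw [← Complex.coe_smul, ← Matrix.mulVec_smul, h4]
    have h6 : Tendsto (fun _ : ℝ => C *ᵥ v) (𝓝[>] (0 : ℝ)) (𝓝 0) :=
      h3.trans_tendsto (tendsto_id.mono_left nhdsWithin_le_nhds)
    exact tendsto_nhds_unique tendsto_const_nhds h6
  have hspan : Submodule.span ℂ {v} = ⊥ := by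
    refine hCA _ (fun x hx => ?_) fun x hx => ?_
    · obtain ⟨c, rfl⟩ := Submodule.mem_span_singleton.1 hx
      rw [Matrix.mulVec_smul, hAv, smul_smul]
      exact Submodule.smul_mem _ _ (Submodule.mem_span_singleton_self v)
    · obtain ⟨c, rfl⟩ := Submodule.mem_span_singleton.1 hx
      rw [Matrix.mulVec_smul, hCv, smul_zero]
  exact hv (Submodule.span_singleton_eq_bot.1 hspan)

theorem continuousAt_inv_of_isUnit_det {M : Matrix ι ι ℂ} (h : IsUnit M.det) :
    ContinuousAt (fun N : Matrix ι ι ℂ => N⁻¹) M := by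
  refine continuousAt_matrix_inv M ?_
  rw [Ring.inverse_eq_inv']
  exact continuousAt_inv₀ h.ne_zero

/-- The bound on the transfer function extends to the imaginary axis by continuity. -/
theorem IsContractive.posSemidef_of_re_nonneg {w : ℝ} {A : Matrix ι ι ℂ} {B : Matrix ι κ ℂ}
    {C : Matrix κ ι ℂ} {D : Matrix κ κ ℂ} (hT : IsContractive w A B C D) {s : ℂ} (hs : 0 ≤ s.re)
    (hu : IsUnit (s • (1 : Matrix ι ι ℂ) - A).det) :
    (1 - (w : ℂ) • ((transfer A B C D s)ᴴ * transfer A B C D s)).PosSemidef := by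
  have h1 : Tendsto (fun t : ℝ => (s + t) • (1 : Matrix ι ι ℂ) - A) (𝓝[>] 0)
      (𝓝 (s • (1 : Matrix ι ι ℂ) - A)) := by
    have : Continuous fun t : ℝ => (s + t) • (1 : Matrix ι ι ℂ) - A := by fun_prop
    simpa using (this.tendsto 0).mono_left nhdsWithin_le_nhds
  have h2 := (continuousAt_inv_of_isUnit_det hu).tendsto.comp h1
  have h3 : Continuous fun M : Matrix ι ι ℂ =>
      1 - (w : ℂ) • ((C * M * B + D)ᴴ * (C * M * B + D)) := by fun_prop
  refine isClosed_posSemidef.mem_of_tendsto ((h3.tendsto _).comp h2) ?_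
  filter_upwards [eventually_isUnit_det A s, self_mem_nhdsWithin] with t ht ht0
  refine hT _ ?_ ht
  rw [Complex.add_re, Complex.ofReal_re]
  exact add_pos_of_nonneg_of_pos hs ht0

/-- The bound on the transfer function passes to its value `D` at infinity. -/
theorem IsContractive.posSemidef_infinity {w : ℝ} {A : Matrix ι ι ℂ} {B : Matrix ι κ ℂ}
    {C : Matrix κ ι ℂ} {D : Matrix κ κ ℂ} (hT : IsContractive w A B C D) :
    (1 - (w : ℂ) • (Dᴴ * D)).PosSemidef := by
  -- at `s = 1 / t` the resolvent is `t (1 - t A)⁻¹`, which tends to `0` with `t`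
  have h1 : Tendsto (fun t : ℝ => (1 : Matrix ι ι ℂ) - t • A) (𝓝[>] 0) (𝓝 1) := by
    have : Continuous fun t : ℝ => (1 : Matrix ι ι ℂ) - t • A := by fun_prop
    simpa using (this.tendsto 0).mono_left nhdsWithin_le_nhds
  have hone : IsUnit (1 : Matrix ι ι ℂ).det := by simp
  have h2 := (continuousAt_inv_of_isUnit_det hone).tendsto.comp h1
  have h2' : Tendsto (fun t : ℝ => t • ((1 : Matrix ι ι ℂ) - t • A)⁻¹) (𝓝[>] 0) (𝓝 0) := by
    have h4 : Tendsto (fun t : ℝ => t) (𝓝[>] 0) (𝓝 0) := nhdsWithin_le_nhds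
    simpa using h4.smul h2
  have h3 : Continuous fun M : Matrix ι ι ℂ =>
      1 - (w : ℂ) • ((C * M * B + D)ᴴ * (C * M * B + D)) := by fun_prop
  have h5 : ∀ᶠ t : ℝ in 𝓝[>] 0, IsUnit ((1 : Matrix ι ι ℂ) - t • A).det := by
    have h6 : Tendsto (fun t : ℝ => ((1 : Matrix ι ι ℂ) - t • A).det) (𝓝[>] 0)
        (𝓝 (1 : Matrix ι ι ℂ).det) := (continuous_id.matrix_det.tendsto _).comp h1
    filter_upwards [h6.eventually_ne (by simp : (1 : Matrix ι ι ℂ).det ≠ 0)] with t ht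
    exact isUnit_iff_ne_zero.2 ht
  have h7 := (h3.tendsto _).comp h2'
  simp only [Matrix.mul_zero, Matrix.zero_mul, zero_add] at h7
  refine isClosed_posSemidef.mem_of_tendsto h7 ?_
  filter_upwards [h5, self_mem_nhdsWithin] with t ht ht0
  have ht0' : (0 : ℝ) < t := ht0
  have h8 : ((t⁻¹ : ℝ) : ℂ) • (1 : Matrix ι ι ℂ) - A = t⁻¹ • ((1 : Matrix ι ι ℂ) - t • A) := by
    rw [smul_sub, smul_smul, inv_mul_cancel₀ ht0'.ne', one_smul, Complex.coe_smul]
  have hleft : (t • ((1 : Matrix ι ι ℂ) - t • A)⁻¹) *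
      (((t⁻¹ : ℝ) : ℂ) • (1 : Matrix ι ι ℂ) - A) = 1 := by
    rw [h8, Matrix.smul_mul, Matrix.mul_smul, smul_smul, mul_inv_cancel₀ ht0'.ne', one_smul,
      Matrix.nonsing_inv_mul _ ht]
  have h9 : (((t⁻¹ : ℝ) : ℂ) • (1 : Matrix ι ι ℂ) - A)⁻¹ = t • ((1 : Matrix ι ι ℂ) - t • A)⁻¹ :=
    Matrix.inv_eq_left_inv hleft
  have h10 := hT ((t⁻¹ : ℝ) : ℂ) (by simpa using ht0') (Matrix.isUnit_det_of_left_inverse hleft)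
  rw [transfer, h9] at h10
  exact h10

end Transfer

/-! ### Lyapunov's theorem and the bounded real lemma -/

section Lyapunov

theorem tendsto_pow_zero_of_spectrum_lt_one {R : Type*} [NormedRing R] [NormedAlgebra ℂ R]
    [CompleteSpace R] {a : R} (ha : ∀ z ∈ spectrum ℂ a, ‖z‖ < 1) :
    Tendsto (fun k : ℕ => a ^ k) atTop (𝓝 0) := by
  rcases subsingleton_or_nontrivial R with _ | _
  · exact tendsto_const_nhds.congr fun k => Subsingleton.elim 0 _
  have hρ : spectralRadius ℂ a < (1 : NNReal) :=
    spectrum.spectralRadius_lt_of_forall_lt a fun z hz => by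
      rw [← NNReal.coe_lt_coe]; exact ha z hz
  obtain ⟨r, hr, hr1⟩ := ENNReal.lt_iff_exists_nnreal_btwn.1 hρ
  rw [ENNReal.coe_lt_coe] at hr1
  have hev : ∀ᶠ k : ℕ in atTop, ‖a ^ k‖ ≤ (r : ℝ) ^ k := by
    filter_upwards [(spectrum.gelfand_formula a).eventually_lt_const hr,
      eventually_gt_atTop 0] with k hk hk0
    have hk0' : (k : ℝ) ≠ 0 := by positivity
    have h1 := ENNReal.rpow_le_rpow hk.le (Nat.cast_nonneg k)
    rw [← ENNReal.rpow_mul, one_div, inv_mul_cancel₀ hk0', ENNReal.rpow_one, ENNReal.rpow_natCast]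
      at h1
    exact_mod_cast h1
  exact squeeze_zero_norm' hev (tendsto_pow_atTop_nhds_zero_of_lt_one r.2 hr1)

variable {ι : Type*} [Fintype ι] [DecidableEq ι]

open scoped Matrix.Norms.L2Operator in
/-- **Lyapunov's theorem**: if all eigenvalues of `A` lie in the open left half plane and
`H A + Aᴴ H ≤ 0`, then `H ≥ 0`. The Cayley transform `E = (1 + A) (1 - A)⁻¹` has its spectrum in
the open unit disc, so `E ^ k` tends to `0`, and `H - (E ^ k)ᴴ H E ^ k ≥ 0` for all `k`. -/
theorem posSemidef_of_lyapunov {A H : Matrix ι ι ℂ}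
    (hA : ∀ s : ℂ, 0 ≤ s.re → IsUnit (s • (1 : Matrix ι ι ℂ) - A).det)
    (h : (-(H * A + Aᴴ * H)).PosSemidef) : H.PosSemidef := by
  have h1 : IsUnit ((1 : Matrix ι ι ℂ) - A).det := by simpa using hA 1 (by simp)
  set N := (1 : Matrix ι ι ℂ) - A with hN
  have hNN : N * N⁻¹ = 1 := Matrix.mul_nonsing_inv _ h1
  set E := (1 + A) * N⁻¹ with hE
  have hstep : (H - Eᴴ * H * E).PosSemidef := by
    have h2 : H - Eᴴ * H * E = (N⁻¹)ᴴ * ((2 : ℂ) • (-(H * A + Aᴴ * H))) * N⁻¹ := by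
      have h3 : (2 : ℂ) • (-(H * A + Aᴴ * H)) = Nᴴ * H * N - (1 + A)ᴴ * H * (1 + A) := by
        rw [hN, Matrix.conjTranspose_sub, Matrix.conjTranspose_add, Matrix.conjTranspose_one]
        noncomm_ring
        simp [two_smul, ← sub_eq_add_neg]
        abel
      have h4 : (N⁻¹)ᴴ * Nᴴ = 1 := by
        rw [← Matrix.conjTranspose_mul, hNN, Matrix.conjTranspose_one]
      calc H - Eᴴ * H * E = ((N⁻¹)ᴴ * Nᴴ) * H * (N * N⁻¹) - Eᴴ * H * E := by
            rw [h4, hNN, one_mul, mul_one]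
        _ = _ := by
            rw [h3, hE, Matrix.conjTranspose_mul]
            noncomm_ring
    rw [h2]
    exact (h.smul (by norm_num)).conjTranspose_mul_mul_same _
  have hpow : ∀ k : ℕ, (H - (E ^ k)ᴴ * H * E ^ k).PosSemidef := by
    intro k
    induction k with
    | zero => simpa using Matrix.PosSemidef.zero
    | succ k ih =>
      have h5 : H - (E ^ (k + 1))ᴴ * H * E ^ (k + 1) =
          (H - Eᴴ * H * E) + Eᴴ * (H - (E ^ k)ᴴ * H * E ^ k) * E := by
        rw [pow_succ, Matrix.conjTranspose_mul]
        noncomm_ring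
      rw [h5]
      exact hstep.add (ih.conjTranspose_mul_mul_same E)
  have hspec : ∀ z ∈ spectrum ℂ E, ‖z‖ < 1 := by
    intro z hz
    by_contra! hz1
    rw [spectrum.mem_iff] at hz
    refine hz ?_
    have h6 : algebraMap ℂ (Matrix ι ι ℂ) z - E = ((z - 1) • 1 - (z + 1) • A) * N⁻¹ := by
      have : algebraMap ℂ (Matrix ι ι ℂ) z = z • (N * N⁻¹) := by
        rw [hNN, Algebra.algebraMap_eq_smul_one]
      rw [this, hE, ← Matrix.smul_mul, ← Matrix.sub_mul, hN]
      congr 1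
      module
    rw [h6]
    refine IsUnit.mul ?_ ((Matrix.isUnit_iff_isUnit_det _).2 (Matrix.isUnit_nonsing_inv_det _ h1))
    rw [Matrix.isUnit_iff_isUnit_det]
    -- the inverse Cayley transform `(z - 1) / (z + 1)` maps `1 ≤ ‖z‖` to the closed right half
    -- plane, and `z = -1` to infinity
    by_cases hz2 : z + 1 = 0
    · have h7 : z - 1 = -2 := by linear_combination hz2
      rw [hz2, h7, zero_smul, sub_zero, Matrix.det_smul, Matrix.det_one, mul_one]
      exact .mk0 _ (pow_ne_zero _ (by norm_num))
    · have h7 : (z - 1) • (1 : Matrix ι ι ℂ) - (z + 1) • A =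
          (z + 1) • (((z - 1) / (z + 1)) • (1 : Matrix ι ι ℂ) - A) := by
        rw [smul_sub, smul_smul, mul_div_cancel₀ _ hz2]
      rw [h7, Matrix.det_smul]
      refine (IsUnit.mk0 _ (pow_ne_zero _ hz2)).mul (hA _ ?_)
      have h8 : 1 ≤ z.re * z.re + z.im * z.im := by
        rw [← Complex.normSq_apply, Complex.normSq_eq_norm_sq]
        nlinarith
      rw [Complex.div_re, ← add_div]
      refine div_nonneg ?_ (Complex.normSq_nonneg _)
      simp
      nlinarith
  have hlim := tendsto_pow_zero_of_spectrum_lt_one hspec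
  have hcont : Continuous fun M : Matrix ι ι ℂ => H - Mᴴ * H * M := by fun_prop
  have h9 := (hcont.tendsto 0).comp hlim
  simp only [Matrix.conjTranspose_zero, Matrix.mul_zero, sub_zero] at h9
  exact isClosed_posSemidef.mem_of_tendsto h9 (Eventually.of_forall hpow)

end Lyapunov

/-- Positive definiteness is an open condition on Hermitian matrices. -/
theorem eventually_posDef {X ι : Type*} [Fintype ι] [TopologicalSpace X] {f : X → Matrix ι ι ℂ}
    (hf : Continuous f) (hH : ∀ x, (f x).IsHermitian) {x₀ : X} (h : (f x₀).PosDef) :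
    ∀ᶠ x in 𝓝 x₀, (f x).PosDef := by
  have hφ : Continuous fun p : X × (ι → ℂ) => (star p.2 ⬝ᵥ (f p.1 *ᵥ p.2)).re := by fun_prop
  have hK : ∀ᶠ x in 𝓝 x₀, ∀ v ∈ Metric.sphere (0 : ι → ℂ) 1, 0 < (star v ⬝ᵥ (f x *ᵥ v)).re := by
    refine (isCompact_sphere (0 : ι → ℂ) 1).eventually_forall_of_forall_eventually fun v hv => ?_
    refine (hφ.tendsto (x₀, v)).eventually_const_lt ?_
    refine (Complex.lt_def.1 (h.dotProduct_mulVec_pos ?_)).1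
    rintro rfl
    simp at hv
  filter_upwards [hK] with x hx
  refine .of_dotProduct_mulVec_pos (hH x) fun v hv => ?_
  refine Complex.lt_def.2 ⟨?_, ((hH x).im_star_dotProduct_mulVec_self v).symm⟩
  have hv' : ‖v‖ ≠ 0 := norm_ne_zero_iff.2 hv
  have h1 := hx (((‖v‖⁻¹ : ℝ) : ℂ) • v) (by simp [norm_smul, hv'])
  rw [Matrix.mulVec_smul, star_smul, smul_dotProduct, dotProduct_smul, smul_eq_mul, smul_eq_mul,
    Complex.star_def, Complex.conj_ofReal, Complex.re_ofReal_mul, Complex.re_ofReal_mul] at h1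
  have h2 : 0 < ‖v‖⁻¹ := by positivity
  exact (mul_pos_iff_of_pos_left h2).1 ((mul_pos_iff_of_pos_left h2).1 h1)

section BoundedReal

variable {ι κ : Type*} [Fintype κ] [DecidableEq κ]

/-- The matrix of the Hermitian form `(x, u) ↦ ⟨u, u⟩ - w ⟨y, y⟩` with the output
`y = C x + D u`. -/
noncomputable def supply (w : ℝ) (C : Matrix κ ι ℂ) (D : Matrix κ κ ℂ) :
    Matrix (ι ⊕ κ) (ι ⊕ κ) ℂ :=
  Matrix.fromBlocks 0 0 0 1 - (w : ℂ) • (Matrix.fromRows Cᴴ Dᴴ * Matrix.fromCols C D)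

theorem isHermitian_supply (w : ℝ) (C : Matrix κ ι ℂ) (D : Matrix κ κ ℂ) :
    (supply w C D).IsHermitian := by
  refine .sub ?_ ?_
  · simp [Matrix.isHermitian_fromBlocks_iff, Matrix.isHermitian_one]
  · rw [← Matrix.conjTranspose_fromCols_eq_fromRows_conjTranspose]
    exact (Matrix.isHermitian_conjTranspose_mul_self _).smul (Complex.conj_ofReal w)

variable [Fintype ι]

theorem dotProduct_supply_mulVec (w : ℝ) (C : Matrix κ ι ℂ) (D : Matrix κ κ ℂ)
    (x : ι → ℂ) (u : κ → ℂ) :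
    star (Sum.elim x u) ⬝ᵥ (supply w C D *ᵥ Sum.elim x u) =
      star u ⬝ᵥ u - w * (star (C *ᵥ x + D *ᵥ u) ⬝ᵥ (C *ᵥ x + D *ᵥ u)) := by
  have hs : star (Sum.elim x u) = Sum.elim (star x) (star u) := by
    ext i; cases i <;> rfl
  have hK : Matrix.fromCols C D *ᵥ Sum.elim x u = C *ᵥ x + D *ᵥ u := by
    simp [Matrix.fromCols_mulVec]
  rw [supply, Matrix.sub_mulVec, dotProduct_sub, Matrix.smul_mulVec, dotProduct_smul,
    ← Matrix.conjTranspose_fromCols_eq_fromRows_conjTranspose, ← Matrix.mulVec_mulVec,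
    Matrix.dotProduct_mulVec _ (Matrix.fromCols C D)ᴴ, ← Matrix.star_mulVec, hK, smul_eq_mul,
    Matrix.fromBlocks_mulVec, hs, sumElim_dotProduct_sumElim]
  simp

theorem brlMatrix_eq {m n : ℕ} (η : EReal) (A : Matrix (Fin n) (Fin n) ℂ)
    (B : Matrix (Fin n) (Fin m) ℂ) (C : Matrix (Fin m) (Fin n) ℂ) (D : Matrix (Fin m) (Fin m) ℂ)
    (H : Matrix (Fin n) (Fin n) ℂ) :
    brlMatrix η A B C D H = supply (weight η) C D - storageRate A B H := by
  rw [brlMatrix, supply, storageRate_apply, sub_right_comm,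
    sub_eq_add_neg (Matrix.fromBlocks 0 0 0 1), Matrix.fromBlocks_neg, Matrix.fromBlocks_add]
  congr 2 <;> simp
  abel

variable {w : ℝ} {A H : Matrix ι ι ℂ} {B : Matrix ι κ ℂ} {C : Matrix κ ι ℂ} {D : Matrix κ κ ℂ}

/-- The dissipation form `supply - storageRate` at a state and an input with
`A x + B u = s x`, that is, along the exponential trajectory `e ^ (s t) (x, u)`. -/
theorem dissipation_eq {s : ℂ} {x : ι → ℂ} {u : κ → ℂ} (hx : A *ᵥ x + B *ᵥ u = s • x) :
    star (Sum.elim x u) ⬝ᵥ ((supply w C D - storageRate A B H) *ᵥ Sum.elim x u) =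
      star u ⬝ᵥ u - w * (star (C *ᵥ x + D *ᵥ u) ⬝ᵥ (C *ᵥ x + D *ᵥ u)) -
        (2 * s.re : ℝ) * (star x ⬝ᵥ (H *ᵥ x)) := by
  have h2 : ((2 * s.re : ℝ) : ℂ) = s + star s := by
    rw [Complex.star_def, Complex.add_conj]
  rw [Matrix.sub_mulVec, dotProduct_sub, dotProduct_supply_mulVec, dotProduct_storageRate_mulVec,
    hx, h2, Matrix.mulVec_smul, dotProduct_smul, star_smul, smul_dotProduct, smul_eq_mul,
    smul_eq_mul, add_mul]

variable [DecidableEq ι]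

/-- A positive definite storage function excludes eigenvalues of `A` from the open right half
plane. -/
theorem isUnit_det_of_storage (hw : 0 < w) (hH : H.PosDef)
    (hM : (supply w C D - storageRate A B H).PosSemidef) {s : ℂ} (hs : 0 < s.re) :
    IsUnit (s • (1 : Matrix ι ι ℂ) - A).det := by
  rw [isUnit_iff_ne_zero]
  intro hdet
  obtain ⟨v, hv, hAv⟩ := Matrix.exists_mulVec_eq_zero_iff.2 hdet
  replace hAv : A *ᵥ v + B *ᵥ 0 = s • v := by
    rw [Matrix.sub_mulVec, Matrix.smul_mulVec, Matrix.one_mulVec, sub_eq_zero] at hAv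
    rw [Matrix.mulVec_zero, add_zero, hAv]
  have h1 := hM.dotProduct_mulVec_nonneg (Sum.elim v 0)
  rw [dissipation_eq hAv] at h1
  have h2 : 0 < ((2 * s.re : ℝ) : ℂ) * (star v ⬝ᵥ (H *ᵥ v)) :=
    mul_pos (by exact_mod_cast (by linarith : 0 < 2 * s.re)) (hH.dotProduct_mulVec_pos hv)
  have h3 : 0 ≤ (w : ℂ) * (star (C *ᵥ v + D *ᵥ 0) ⬝ᵥ (C *ᵥ v + D *ᵥ 0)) :=
    mul_nonneg (by exact_mod_cast hw.le) (dotProduct_star_self_nonneg _)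
  simp only [dotProduct_zero, zero_sub] at h1
  have h4 := add_nonneg h1 h3
  rw [add_comm, add_sub, add_neg_cancel, zero_sub] at h4
  exact absurd (neg_nonneg.1 h4) (not_le_of_gt h2)

/-- A positive semidefinite storage function bounds the transfer function: with
`x = (s - A)⁻¹ B u` the dissipation form at `(x, u)` is `⟨u, u⟩ - w ⟨T u, T u⟩` minus the
nonnegative number `2 Re s ⟨x, H x⟩`. -/
theorem posSemidef_of_storage (hH : H.PosSemidef)
    (hM : (supply w C D - storageRate A B H).PosSemidef) {s : ℂ} (hs : 0 ≤ s.re)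
    (hu : IsUnit (s • (1 : Matrix ι ι ℂ) - A).det) :
    (1 - (w : ℂ) • ((transfer A B C D s)ᴴ * transfer A B C D s)).PosSemidef := by
  refine .of_dotProduct_mulVec_nonneg ?_ fun u => ?_
  · exact Matrix.isHermitian_one.sub
      ((Matrix.isHermitian_conjTranspose_mul_self _).smul (Complex.conj_ofReal w))
  · set x := (s • (1 : Matrix ι ι ℂ) - A)⁻¹ *ᵥ (B *ᵥ u) with hx
    have h1 : A *ᵥ x + B *ᵥ u = s • x := by
      have : (s • (1 : Matrix ι ι ℂ) - A) *ᵥ x = B *ᵥ u := by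
        rw [hx, Matrix.mulVec_mulVec, Matrix.mul_nonsing_inv _ hu, Matrix.one_mulVec]
      rw [← this, Matrix.sub_mulVec, Matrix.smul_mulVec, Matrix.one_mulVec, add_sub_cancel]
    have h2 : transfer A B C D s *ᵥ u = C *ᵥ x + D *ᵥ u := by
      rw [transfer_mulVec]
    have h3 := hM.dotProduct_mulVec_nonneg (Sum.elim x u)
    rw [dissipation_eq h1, ← h2, sub_nonneg] at h3
    rw [dotProduct_one_sub_smul_mulVec]
    exact (mul_nonneg (by exact_mod_cast (by linarith : 0 ≤ 2 * s.re))
      (hH.dotProduct_mulVec_nonneg x)).trans h3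

/-- A Hermitian solution of the matrix inequality is positive definite if `A` has its spectrum in
the open left half plane and `(C, A)` is observable: the kernel of `H` is an `A`-invariant
subspace of the kernel of `C`. -/
theorem posDef_of_posSemidef_sub_storageRate (hw : 0 < w) (hCA : IsObservable C A)
    (hA : ∀ s : ℂ, 0 ≤ s.re → IsUnit (s • (1 : Matrix ι ι ℂ) - A).det) (hH : H.IsHermitian)
    (hM : (supply w C D - storageRate A B H).PosSemidef) : H.PosDef := by
  have hform : ∀ x, star x ⬝ᵥ (-(H * A + Aᴴ * H) *ᵥ x) =
      star (Sum.elim x 0) ⬝ᵥ ((supply w C D - storageRate A B H) *ᵥ Sum.elim x (0 : κ → ℂ)) +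
        w * (star (C *ᵥ x) ⬝ᵥ (C *ᵥ x)) := by
    intro x
    rw [Matrix.sub_mulVec, dotProduct_sub, dotProduct_supply_mulVec, dotProduct_storageRate_mulVec]
    simp [Matrix.neg_mulVec, Matrix.add_mulVec, ← Matrix.mulVec_mulVec, Matrix.star_mulVec,
      ← Matrix.dotProduct_mulVec]
    ring
  have hw' : (0 : ℂ) < w := by exact_mod_cast hw
  have hQ : (-(H * A + Aᴴ * H)).PosSemidef := by
    refine .of_dotProduct_mulVec_nonneg ?_ fun x => ?_
    · simp [Matrix.IsHermitian, Matrix.conjTranspose_mul, hH.eq, add_comm]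
    · rw [hform]
      exact add_nonneg (hM.dotProduct_mulVec_nonneg _)
        (mul_nonneg hw'.le (dotProduct_star_self_nonneg _))
  have hHpos := posSemidef_of_lyapunov hA hQ
  have hker : LinearMap.ker H.mulVecLin = ⊥ := by
    have hzero : ∀ x, H *ᵥ x = 0 → star x ⬝ᵥ (-(H * A + Aᴴ * H) *ᵥ x) = 0 := by
      intro x hx
      have hx' : star x ᵥ* H = 0 := by rw [← hH.eq, ← Matrix.star_mulVec, hx, star_zero]
      rw [Matrix.neg_mulVec, Matrix.add_mulVec, ← Matrix.mulVec_mulVec, ← Matrix.mulVec_mulVec,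
        hx, Matrix.mulVec_zero, add_zero, dotProduct_neg, Matrix.dotProduct_mulVec, hx',
        zero_dotProduct, neg_zero]
    refine hCA _ (fun x hx => ?_) fun x hx => ?_ <;>
      rw [LinearMap.mem_ker, Matrix.mulVecLin_apply] at hx
    · rw [LinearMap.mem_ker, Matrix.mulVecLin_apply]
      have h1 := (hQ.dotProduct_mulVec_zero_iff x).1 (hzero x hx)
      rw [Matrix.neg_mulVec, Matrix.add_mulVec, ← Matrix.mulVec_mulVec, ← Matrix.mulVec_mulVec,
        hx, Matrix.mulVec_zero, add_zero, neg_eq_zero] at h1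
      exact h1
    · have h1 := hzero x hx
      rw [hform] at h1
      have h2 := (add_eq_zero_iff_of_nonneg (hM.dotProduct_mulVec_nonneg _)
        (mul_nonneg hw'.le (dotProduct_star_self_nonneg _))).1 h1
      exact dotProduct_star_self_eq_zero.1 ((mul_eq_zero.1 h2.2).resolve_left hw'.ne')
  refine Matrix.PosDef.of_dotProduct_mulVec_pos hH fun x hx => ?_
  refine lt_of_le_of_ne (hHpos.dotProduct_mulVec_nonneg x) fun h => hx ?_
  have h1 : x ∈ LinearMap.ker H.mulVecLin := (hHpos.dotProduct_mulVec_zero_iff x).1 h.symm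
  rwa [hker, Submodule.mem_bot] at h1

/-- The nonstrict bounded real lemma for a minimal system: the Kalman–Yakubovich–Popov lemma
applies because on the frequency pairs the supply is the form `1 - w Tᴴ T`. -/
theorem IsContractive.exists_storage (hw : 0 < w) (hT : IsContractive w A B C D)
    (hAB : IsControllable A B) (hCA : IsObservable C A) :
    ∃ H : Matrix ι ι ℂ, H.PosDef ∧ (supply w C D - storageRate A B H).PosSemidef := by
  have hA := hT.isUnit_det hw hAB hCA
  obtain ⟨H, hH, hM⟩ := exists_posSemidef_sub_storageRate hAB (isHermitian_supply w C D)
    fun x u hxu => by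
      rw [dotProduct_supply_mulVec]
      rcases hxu with rfl | ⟨ω, hω⟩
      · have h1 := hT.posSemidef_infinity.dotProduct_mulVec_nonneg u
        rw [dotProduct_one_sub_smul_mulVec] at h1
        simpa using h1
      · have hre : 0 ≤ ((ω : ℂ) * Complex.I).re := by simp
        have h1 := (hT.posSemidef_of_re_nonneg hre (hA _ hre)).dotProduct_mulVec_nonneg u
        have h2 : x = (((ω : ℂ) * Complex.I) • (1 : Matrix ι ι ℂ) - A)⁻¹ *ᵥ (B *ᵥ u) := by
          have h3 : B *ᵥ u = (((ω : ℂ) * Complex.I) • (1 : Matrix ι ι ℂ) - A) *ᵥ x := by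
            rw [Matrix.sub_mulVec, Matrix.smul_mulVec, Matrix.one_mulVec, ← hω,
              add_sub_cancel_left]
          rw [h3, Matrix.mulVec_mulVec, Matrix.nonsing_inv_mul _ (hA _ hre), Matrix.one_mulVec]
        have h4 : transfer A B C D ((ω : ℂ) * Complex.I) *ᵥ u = C *ᵥ x + D *ᵥ u := by
          rw [transfer_mulVec, ← h2]
        rwa [dotProduct_one_sub_smul_mulVec, h4] at h1
  exact ⟨H, posDef_of_posSemidef_sub_storageRate hw hCA hA hH hM, hM⟩

/-- The matrix inequality has a solution at which it is singular: `H + t` solves it for a bounded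
closed set of `t ≥ 0`, by controllability, and at the largest such `t` it cannot be strict. -/
theorem exists_storage_det_eq_zero [Nonempty ι] (hAB : IsControllable A B) (hH : H.PosDef)
    (hM : (supply w C D - storageRate A B H).PosSemidef) :
    ∃ H' : Matrix ι ι ℂ, H'.PosDef ∧ (supply w C D - storageRate A B H').PosSemidef ∧
      (supply w C D - storageRate A B H').det = 0 := by
  let M : ℝ → Matrix (ι ⊕ κ) (ι ⊕ κ) ℂ := fun t => supply w C D - storageRate A B (H + t • 1)
  have hMt : ∀ t, M t = (supply w C D - storageRate A B H) - t • storageRate A B 1 := by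
    intro t
    simp only [M, map_add, map_smul]
    abel
  have hherm : ∀ t : ℝ, (H + t • (1 : Matrix ι ι ℂ)).IsHermitian := fun t =>
    hH.isHermitian.add (Matrix.isHermitian_one.smul (.all t))
  have hcont : Continuous M := by
    rw [funext hMt]
    fun_prop
  -- an unbounded set of `t` would give `-storageRate A B 1 ≥ 0`, by division by `t`
  let S : Set ℝ := {t | 0 ≤ t ∧ (M t).PosSemidef}
  have hSclosed : IsClosed S := isClosed_Ici.inter (isClosed_posSemidef.preimage hcont)
  have hS0 : (0 : ℝ) ∈ S := ⟨le_rfl, by rw [hMt]; simpa using hM⟩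
  have hSbdd : BddAbove S := by
    by_contra hunb
    have hfreq : ∃ᶠ t : ℝ in atTop, (t⁻¹ • M t).PosSemidef := by
      rw [frequently_atTop]
      intro a
      obtain ⟨t, ht, hat⟩ := not_bddAbove_iff.1 hunb a
      refine ⟨t, hat.le, ?_⟩
      rw [← Complex.coe_smul]
      exact ht.2.smul (by exact_mod_cast inv_nonneg.2 ht.1)
    have hlim : Tendsto (fun t : ℝ => t⁻¹ • M t) atTop (𝓝 (-storageRate A B 1)) := by
      have h1 : Tendsto (fun t : ℝ => t⁻¹ • (supply w C D - storageRate A B H) - storageRate A B 1)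
          atTop (𝓝 ((0 : ℝ) • (supply w C D - storageRate A B H) - storageRate A B 1)) :=
        (tendsto_inv_atTop_zero.smul_const _).sub_const _
      rw [zero_smul, zero_sub] at h1
      refine h1.congr' ?_
      filter_upwards [eventually_gt_atTop 0] with t ht
      rw [hMt, smul_sub t⁻¹ _ (t • _), smul_smul, inv_mul_cancel₀ ht.ne', one_smul]
    have h2 := eq_zero_of_posSemidef_neg_storageRate hAB Matrix.isHermitian_one
      (isClosed_posSemidef.mem_of_frequently_of_tendsto hfreq hlim)
    exact one_ne_zero h2
  have hmax := hSclosed.csSup_mem ⟨0, hS0⟩ hSbdd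
  set t₀ := sSup S
  have hpd : (H + t₀ • (1 : Matrix ι ι ℂ)).PosDef := by
    refine hH.add_posSemidef ?_
    rw [← Complex.coe_smul]
    exact Matrix.PosSemidef.one.smul (by exact_mod_cast hmax.1)
  refine ⟨_, hpd, hmax.2, ?_⟩
  by_contra hdet
  have hpos : (M t₀).PosDef :=
    hmax.2.posDef_iff_isUnit.2 ((Matrix.isUnit_iff_isUnit_det _).2 (isUnit_iff_ne_zero.2 hdet))
  have hev := (eventually_posDef hcont
    (fun t => (isHermitian_supply w C D).sub (isHermitian_storageRate A B (hherm t))) hpos)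
  obtain ⟨t, ht, htpos⟩ := ((hev.filter_mono nhdsWithin_le_nhds).and
    (self_mem_nhdsWithin (s := Set.Ioi t₀))).exists
  have htpos' : t₀ < t := htpos
  exact absurd (le_csSup hSbdd ⟨hmax.1.trans htpos'.le, ht.posSemidef⟩) (not_le.2 htpos')

end BoundedReal

/-! ### The weight and the class `HB` -/

theorem weight_pos {η : EReal} (hη : 1 < η) : 0 < weight η := by
  induction η with
  | bot => simp at hη
  | top => simp [weight]
  | coe r =>
    have hr : 1 < r := by exact_mod_cast hη
    simp only [weight, EReal.coe_ne_top, if_false, EReal.toReal_coe]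
    exact div_pos (by linarith) (by linarith)

/-- The weight is continuous from the left, also at `η = ∞`. -/
theorem exists_lt_weight_mem {η : EReal} (hη : 1 < η) {U : Set ℝ} (hU : U ∈ 𝓝 (weight η)) :
    ∃ θ : EReal, 1 < θ ∧ θ < η ∧ weight θ ∈ U := by
  have hcoe : ∀ r : ℝ, weight r = (r + 1) / (r - 1) := fun r => by simp [weight]
  induction η with
  | bot => simp at hη
  | top =>
    have h1 : Tendsto (fun r : ℝ => 1 + 2 / (r - 1)) atTop (𝓝 (1 + 0)) :=
      tendsto_const_nhds.add
        (tendsto_const_nhds.div_atTop (tendsto_atTop_add_const_right _ _ tendsto_id))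
    have hw : weight ⊤ = 1 + 0 := by simp [weight]
    rw [hw] at hU
    obtain ⟨r, hr, hr1⟩ := ((h1.eventually_mem hU).and (eventually_gt_atTop 1)).exists
    refine ⟨r, by exact_mod_cast hr1, EReal.coe_lt_top r, ?_⟩
    have hr0 : r - 1 ≠ 0 := by linarith
    have h2 : (r + 1) / (r - 1) = 1 + 2 / (r - 1) := by
      field_simp
      ring
    rwa [hcoe, h2]
  | coe r₀ =>
    have hr : 1 < r₀ := by exact_mod_cast hη
    rw [hcoe] at hU
    have h1 : ContinuousAt (fun r : ℝ => (r + 1) / (r - 1)) r₀ :=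
      (by fun_prop : ContinuousAt (fun r : ℝ => r + 1) r₀).div (by fun_prop) (by linarith)
    have h2 : ∀ᶠ r in 𝓝[<] r₀, (r + 1) / (r - 1) ∈ U :=
      (h1.tendsto.mono_left nhdsWithin_le_nhds).eventually_mem hU
    have h3 : ∀ᶠ r in 𝓝[<] r₀, 1 < r := (eventually_gt_nhds hr).filter_mono nhdsWithin_le_nhds
    obtain ⟨r, ⟨hrU, hr1⟩, hlt⟩ := ((h2.and h3).and self_mem_nhdsWithin).exists
    have hlt' : r < r₀ := hlt
    exact ⟨r, by exact_mod_cast hr1, by exact_mod_cast hlt', by rwa [hcoe]⟩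

variable {m n : ℕ} {G : RatMatrix m} {A : Matrix (Fin n) (Fin n) ℂ}
  {B : Matrix (Fin n) (Fin m) ℂ} {C : Matrix (Fin m) (Fin n) ℂ} {D : Matrix (Fin m) (Fin m) ℂ}

theorem HB.isContractive {η : EReal} (h : HB η G) (hreal : IsRealization G A B C D) :
    IsContractive (weight η) A B C D := by
  intro s hs hu
  have h1 := (h s hs).2
  rwa [(hreal.isAnalyticAt_and_evalAt hu).2] at h1

theorem HB.of_storage {η : EReal} (hη : 1 < η) (hreal : IsRealization G A B C D)
    {H : Matrix (Fin n) (Fin n) ℂ} (hH : H.PosDef) (hM : (brlMatrix η A B C D H).PosSemidef) :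
    HB η G := by
  intro s hs
  rw [brlMatrix_eq] at hM
  have hu := isUnit_det_of_storage (weight_pos hη) hH hM hs
  obtain ⟨h1, h2⟩ := hreal.isAnalyticAt_and_evalAt hu
  exact ⟨h1, h2 ▸ posSemidef_of_storage hH.posSemidef hM hs.le hu⟩

theorem HB.exists_storage {η : EReal} (hη : 1 < η) (h : HB η G) (hn : mcMillanDegree G = n)
    (hreal : IsRealization G A B C D) :
    ∃ H : Matrix (Fin n) (Fin n) ℂ, H.PosDef ∧ (brlMatrix η A B C D H).PosSemidef := by
  simp only [brlMatrix_eq]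
  exact (h.isContractive hreal).exists_storage (weight_pos hη) (hreal.isControllable hn)
    (hreal.isObservable hn)

end HyperBounded

theorem mainTheorem4 (m n : ℕ) (G : HyperBounded.RatMatrix m)
    (hG : HyperBounded.NoPoleAtInfinity G) (hn : HyperBounded.mcMillanDegree G = n)
    (A : Matrix (Fin n) (Fin n) ℂ) (B : Matrix (Fin n) (Fin m) ℂ)
    (C : Matrix (Fin m) (Fin n) ℂ) (D : Matrix (Fin m) (Fin m) ℂ)
    (hreal : HyperBounded.IsRealization G A B C D)
    (η : EReal) (hη : 1 < η) :
    (HyperBounded.HB η G ↔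
      ∃ H : Matrix (Fin n) (Fin n) ℂ, H.PosDef ∧
        (HyperBounded.brlMatrix η A B C D H).PosSemidef) ∧
    (1 ≤ n → HyperBounded.HB η G →
      ∃ H : Matrix (Fin n) (Fin n) ℂ, H.PosDef ∧
        (HyperBounded.brlMatrix η A B C D H).PosSemidef ∧
        (HyperBounded.brlMatrix η A B C D H).det = 0) ∧
    (IsLeast {θ : EReal | 1 < θ ∧ HyperBounded.HB θ G} η →
      ∀ H : Matrix (Fin n) (Fin n) ℂ, H.PosDef →
        (HyperBounded.brlMatrix η A B C D H).PosSemidef →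
        (HyperBounded.brlMatrix η A B C D H).det = 0) := by
  refine ⟨⟨fun h => h.exists_storage hη hn hreal,
    fun ⟨H, hH, hM⟩ => .of_storage hη hreal hH hM⟩, fun hn1 h => ?_, fun hleast H hH hM => ?_⟩
  · obtain ⟨H, hH, hM⟩ := h.exists_storage hη hn hreal
    have : Nonempty (Fin n) := ⟨⟨0, hn1⟩⟩
    simp only [HyperBounded.brlMatrix_eq] at hM ⊢
    exact HyperBounded.exists_storage_det_eq_zero (hreal.isControllable hn) hH hM
  · by_contra hdet
    have hpos : (HyperBounded.brlMatrix η A B C D H).PosDef :=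
      hM.posDef_iff_isUnit.2 ((Matrix.isUnit_iff_isUnit_det _).2 (isUnit_iff_ne_zero.2 hdet))
    rw [HyperBounded.brlMatrix_eq] at hpos
    -- a strict inequality survives a slightly larger weight, that is, a slightly smaller `η`
    have hev := HyperBounded.eventually_posDef
      (f := fun w : ℝ => HyperBounded.supply w C D - HyperBounded.storageRate A B H)
      (by unfold HyperBounded.supply; fun_prop)
      (fun w => (HyperBounded.isHermitian_supply w C D).sub
        (HyperBounded.isHermitian_storageRate A B hH.isHermitian)) hpos
    obtain ⟨θ, hθ, hθη, hw⟩ := HyperBounded.exists_lt_weight_mem hη hev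
    have hHB : HyperBounded.HB θ G := .of_storage hθ hreal hH (by
      rw [HyperBounded.brlMatrix_eq]
      exact Matrix.PosDef.posSemidef hw)
    exact absurd (hleast.2 ⟨hθ, hHB⟩) (not_le_of_gt hθη)
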